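/- Let $\ell,k,r$ be positive integers with $k<\ell$ and $r\ge 2$, and let $\mathcal M\subset\mathbb R^\ell$ be an imbedded $k$-dimensional submanifold of class $C^r$. Let $\mathcal U\subset\mathbb R^\ell$ be open and let $\phi:\mathcal U\to\mathcal M$ be a map of class $C^{r-1}$ (a tubular projection) such that $\phi(p)=p$ for all $p\in\mathcal M\cap\mathcal U$, such that for every $x\in\mathcal U$ the vector $x-\phi(x)$ is orthogonal to the tangent space $T_{\phi(x)}\mathcal M$, and such that $\epsilon x+(1-\epsilon)\phi(x)\in\mathcal U$ for all $x\in\mathcal U$ and $\epsilon\in[0,1]$. For $x\in\mathcal U$ let $P(x):\mathbb R^\ell\to\mathbb R^\ell$ be the orthogonal projection onto the orthogonal complement of $T_{\phi(x)}\mathcal M$. Let $\Omega$ be a nonempty bounded domain (connected open set) in $\mathbb R^\ell$ with $\operatorname{Cl}\Omega\subset\mathcal U$; no regularity of $\partial\Omega$ is assumed. For $p\in\mathcal M$ let $\Omega_p:=\{x\in\Omega\mid\phi(x)=p\}$ and, for $\bar x\in\Omega_p$, let $\Omega_p(\bar x)$ be the connected component of $\Omega_p$ containing $\bar x$. Let $\mathcal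 H^m$ denote $m$-dimensional Hausdorff measure on $\mathbb R^\ell$. Then for every $u\in H^1(\Omega)$, with weak gradient $\nabla u$, the following conditions are equivalent: 1. $P(x)\nabla u(x)=0$ for almost every $x\in\Omega$ (that is, $u\in H^1_s(\Omega)$); 2. there is a set $Z\subset\mathcal M$ with $\mathcal H^k(Z)=0$ and, for every $p\in\mathcal M\setminus Z$, a set $S_p\subset\phi^{-1}(p)$ with $\mathcal H^{\ell-k}(S_p)=0$, such that for all $p\in\mathcal M\setminus Z$ and all $\bar x\in\Omega_p$ there is a constant $v(p,\bar x)\in\mathbb R$ with $u(x)=v(p,\bar x)$ for all $x\in\Omega_p(\bar x)\setminus S_p$. Here $u$ may be any representative of its class in $H^1(\Omega)$. -/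

import Mathlib

open MeasureTheory Measure Set Filter Topology
open scoped ContDiff

noncomputable section

namespace ThinDomain

/-- `M` is an imbedded `k`-dimensional submanifold of `ℝ^ℓ` of class `C^r` (for `k ≤ ℓ`): around each
of its points some `C^r` diffeomorphism between open sets of `ℝ^ℓ` and of `ℝ^k × ℝ^(ℓ-k)`
straightens `M` to `ℝ^k × {0}`. -/
def IsImbeddedSubmanifold {ℓ : ℕ} (r k : ℕ) (M : Set (EuclideanSpace ℝ (Fin ℓ))) : Prop :=
  ∀ p ∈ M, ∃ Ψ : OpenPartialHomeomorph (EuclideanSpace ℝ (Fin ℓ))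
      (EuclideanSpace ℝ (Fin k) × EuclideanSpace ℝ (Fin (ℓ - k))),
    p ∈ Ψ.source ∧ ContDiffOn ℝ r Ψ Ψ.source ∧ ContDiffOn ℝ r Ψ.symm Ψ.target ∧
    ∀ x ∈ Ψ.source, x ∈ M ↔ (Ψ x).2 = 0

/-- The tangent space `T_p M`, as a linear subspace of `ℝ^ℓ`: the velocities at `p` of the curves
in `M` through `p`. (For a submanifold these velocities already form a linear subspace, so that
taking the span adds nothing.) -/
def tangentSpaceAt {ℓ : ℕ} (M : Set (EuclideanSpace ℝ (Fin ℓ))) (p : EuclideanSpace ℝ (Fin ℓ)) :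
    Submodule ℝ (EuclideanSpace ℝ (Fin ℓ)) :=
  Submodule.span ℝ {v | ∃ γ : ℝ → EuclideanSpace ℝ (Fin ℓ),
    γ 0 = p ∧ (∀ᶠ t in 𝓝 0, γ t ∈ M) ∧ HasDerivAt γ v 0}

/-- `φ : U → M` is a tubular projection of class `C^(r-1)` of the open set `U` onto (a part of) `M`:
`φ` fixes the points of `M` in `U`, the vector `x - φ x` is normal to `M` at `φ x`, and `U`
contains with `x` the segment from `φ x` to `x`. Values of `φ` outside `U` play no role. -/
structure IsTubularProjection {ℓ : ℕ} (r : ℕ) (M U : Set (EuclideanSpace ℝ (Fin ℓ)))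
    (φ : EuclideanSpace ℝ (Fin ℓ) → EuclideanSpace ℝ (Fin ℓ)) : Prop where
  isOpen : IsOpen U
  contDiffOn : ContDiffOn ℝ (r - 1 : ℕ) φ U
  mapsTo : MapsTo φ U M
  fixed : ∀ p ∈ M ∩ U, φ p = p
  normal : ∀ x ∈ U, x - φ x ∈ (tangentSpaceAt M (φ x))ᗮ
  segment : ∀ x ∈ U, ∀ ε ∈ Icc (0 : ℝ) 1, ε • x + (1 - ε) • φ x ∈ U

/-- `Q(x)`: the orthogonal projection of `ℝ^ℓ` onto `T_{φ x} M`. -/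
def tangentialProj {ℓ : ℕ} (M : Set (EuclideanSpace ℝ (Fin ℓ)))
    (φ : EuclideanSpace ℝ (Fin ℓ) → EuclideanSpace ℝ (Fin ℓ)) (x : EuclideanSpace ℝ (Fin ℓ)) :
    EuclideanSpace ℝ (Fin ℓ) →L[ℝ] EuclideanSpace ℝ (Fin ℓ) :=
  (tangentSpaceAt M (φ x)).starProjection

/-- `P(x) = I - Q(x)`: the orthogonal projection onto the normal space of `M` at `φ x`. -/
def normalProj {ℓ : ℕ} (M : Set (EuclideanSpace ℝ (Fin ℓ)))
    (φ : EuclideanSpace ℝ (Fin ℓ) → EuclideanSpace ℝ (Fin ℓ)) (x : EuclideanSpace ℝ (Fin ℓ)) :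
    EuclideanSpace ℝ (Fin ℓ) →L[ℝ] EuclideanSpace ℝ (Fin ℓ) :=
  ContinuousLinearMap.id ℝ _ - tangentialProj M φ x

/-- `g` is square integrable on `Ω` and is the weak gradient of `u` there: for each test function
`ψ ∈ C_c^∞(Ω)` and each direction `v`, `∫_Ω u ∂_v ψ = - ∫_Ω ψ ⟨g, v⟩`. -/
def IsL2WeakGradient {ℓ : ℕ} (Ω : Set (EuclideanSpace ℝ (Fin ℓ)))
    (u : EuclideanSpace ℝ (Fin ℓ) → ℝ)
    (g : EuclideanSpace ℝ (Fin ℓ) → EuclideanSpace ℝ (Fin ℓ)) : Prop :=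
  MemLp g 2 (volume.restrict Ω) ∧
  ∀ ψ : EuclideanSpace ℝ (Fin ℓ) → ℝ, ContDiff ℝ ∞ ψ → HasCompactSupport ψ → tsupport ψ ⊆ Ω →
    ∀ v : EuclideanSpace ℝ (Fin ℓ),
      ∫ x in Ω, u x * fderiv ℝ ψ x v = - ∫ x in Ω, ψ x * inner ℝ (g x) v

/-- `u` represents an element of the Sobolev space `H¹(Ω)`. -/
def MemH1 {ℓ : ℕ} (Ω : Set (EuclideanSpace ℝ (Fin ℓ)))
    (u : EuclideanSpace ℝ (Fin ℓ) → ℝ) : Prop :=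
  MemLp u 2 (volume.restrict Ω) ∧ ∃ g, IsL2WeakGradient Ω u g

open Classical in
/-- The weak gradient `∇u` on `Ω` of `u ∈ H¹(Ω)`, well defined up to null sets
(`0` if there is none). -/
def weakGradient {ℓ : ℕ} (Ω : Set (EuclideanSpace ℝ (Fin ℓ)))
    (u : EuclideanSpace ℝ (Fin ℓ) → ℝ) : EuclideanSpace ℝ (Fin ℓ) → EuclideanSpace ℝ (Fin ℓ) :=
  if h : ∃ g, IsL2WeakGradient Ω u g then h.choose else 0

theorem MemH1.isL2WeakGradient {ℓ : ℕ} {Ω : Set (EuclideanSpace ℝ (Fin ℓ))}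
    {u : EuclideanSpace ℝ (Fin ℓ) → ℝ} (hu : MemH1 Ω u) :
    IsL2WeakGradient Ω u (weakGradient Ω u) := by
  rw [weakGradient, dif_pos hu.2]
  exact hu.2.choose_spec

/-- The normal section `{x ∈ A | φ x = p}` of a set `A` at `p`. -/
def normalSection {ℓ : ℕ} (A : Set (EuclideanSpace ℝ (Fin ℓ)))
    (φ : EuclideanSpace ℝ (Fin ℓ) → EuclideanSpace ℝ (Fin ℓ)) (p : EuclideanSpace ℝ (Fin ℓ)) :
    Set (EuclideanSpace ℝ (Fin ℓ)) :=
  {x ∈ A | φ x = p}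

end ThinDomain

end

namespace ThinDomain

/-! The question is local in `Ω`, which is why the boundary plays no role. Read in a chart of `M`,
`φ` becomes a `C¹` map `κ` to `ℝ^k`. With `ψ` the inverse parametrization, differentiating `⟨Dψ(κ x)
e, x - ψ(κ x)⟩ = 0` along `v ∈ ker Dκ` leaves `⟨Dψ e, v⟩ = 0`. So `ker Dκ` lies in the normal space,
and a dimension count gives equality (`exists_local_coordinate`). Completing `κ` by normal
coordinates yields a bi-Lipschitz `C¹` chart onto a product of balls in which the fibers of `φ`
become the plaques `{y} × ball` (`exists_fiberChart`).

The condition `P ∇u = 0` then says that the weak derivatives of `u ∘ Φ⁻¹` along the plaques vanish.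
As the chart is only `C¹`, test functions transport to vector fields that are merely continuous, but
whose distributional divergence is continuous; mollification admits these
(`IsL2WeakGradient.integral_mul_div`, `FiberChart.integral_mul_fderiv_eq`). On a box, vanishing
derivatives mean a.e. constancy on a.e. plaque: one direction by translations
(`ae_exists_ae_eq_const`), the other by Fubini (`FiberChart.integral_mul_fderiv_eq_zero`).

Bi-Lipschitz charts match Lebesgue null sets of parameters with Hausdorff null sets. Countably many
charts cover `Ω`; their bad plaques form `Z`, their bad points `S p`. Plaques of two charts through
a common point share an open piece, so the plaque value is locally constant on a section, hence
constant on its components (`isConstOnSections_of_ae_plaque_const`). -/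

theorem integrable_mul_of_hasCompactSupport {A : Type*} [TopologicalSpace A] [MeasurableSpace A]
    [OpensMeasurableSpace A]
    {μ : Measure A} {u f : A → ℝ} (hu : Integrable u μ) (hf : Continuous f)
    (hc : HasCompactSupport f) : Integrable (fun x => u x * f x) μ := by
  obtain ⟨C, hC⟩ := hc.exists_bound_of_continuous hf
  have hm : AEStronglyMeasurable f μ := hf.aestronglyMeasurable
  exact hu.mul_bdd hm (Eventually.of_forall hC)

/-! ### Weak gradients tested against continuous vector fields -/

section WeakGradient

variable {ℓ : ℕ}

local notation "𝔼" => EuclideanSpace ℝ (Fin ℓ)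

theorem fderiv_convolution_apply {ρ f : 𝔼 → ℝ} (hρ : ContDiff ℝ ∞ ρ) (hρc : HasCompactSupport ρ)
    (hf : Continuous f) (x v : 𝔼) :
    fderiv ℝ (convolution ρ f (ContinuousLinearMap.lsmul ℝ ℝ) volume) x v =
      ∫ t, f t * fderiv ℝ ρ (x - t) v := by
  have h1 := hρc.hasFDerivAt_convolution_left (ContinuousLinearMap.lsmul ℝ ℝ)
    (hρ.of_le (by exact_mod_cast le_top)) (hf.locallyIntegrable (μ := volume)) x
  rw [h1.fderiv, convolution_eq_swap, ContinuousLinearMap.integral_apply]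
  · simp [ContinuousLinearMap.precompL_apply, mul_comm]
  · have h2 : ConvolutionExists (fderiv ℝ ρ) f
        (ContinuousLinearMap.precompL 𝔼 (ContinuousLinearMap.lsmul ℝ ℝ)) volume :=
      (hρc.fderiv ℝ).convolutionExists_left _ (hρ.continuous_fderiv (by simp))
        hf.locallyIntegrable
    have h3 := (h2 x).integrable_swap
    exact h3

/-- The divergence of a mollified vector field is the mollified distributional divergence. -/
theorem sum_fderiv_convolution_eq {X : 𝔼 → 𝔼} {h : 𝔼 → ℝ} (hX : Continuous X)
    (hdiv : ∀ γ : 𝔼 → ℝ, ContDiff ℝ ∞ γ → HasCompactSupport γ →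
      ∫ x, fderiv ℝ γ x (X x) = - ∫ x, h x * γ x)
    {ρ : 𝔼 → ℝ} (hρ : ContDiff ℝ ∞ ρ) (hρc : HasCompactSupport ρ) (x : 𝔼) :
    ∑ i, fderiv ℝ (convolution ρ (fun t => X t i) (ContinuousLinearMap.lsmul ℝ ℝ) volume) x
        (EuclideanSpace.basisFun (Fin ℓ) ℝ i) =
      convolution ρ h (ContinuousLinearMap.lsmul ℝ ℝ) volume x := by
  have hXi : ∀ i, Continuous fun t => X t i := fun i => by fun_prop
  -- The test function is the reflected kernel centred at `x`; the sign from the reflection cancels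
  -- the one in `hdiv`.
  have hγ : ContDiff ℝ ∞ fun t => ρ (x - t) := hρ.comp (by fun_prop)
  have hγc : HasCompactSupport fun t => ρ (x - t) :=
    hρc.comp_homeomorph (Homeomorph.subLeft x)
  have hd : ∀ t v, fderiv ℝ (fun t => ρ (x - t)) t v = - fderiv ℝ ρ (x - t) v := by
    intro t v
    have h1 : HasFDerivAt (fun t => ρ (x - t))
        ((fderiv ℝ ρ (x - t)).comp (-ContinuousLinearMap.id ℝ 𝔼)) t :=
      ((hρ.differentiable (by simp)).differentiableAt.hasFDerivAt (x := x - t)).comp t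
        ((hasFDerivAt_id t).const_sub x)
    rw [h1.fderiv]
    simp
  have hdc : Continuous fun t => fderiv ℝ ρ (x - t) :=
    (hρ.continuous_fderiv (by simp)).comp (by fun_prop)
  have hdcs : HasCompactSupport fun t => fderiv ℝ ρ (x - t) :=
    (hρc.fderiv ℝ).comp_homeomorph (Homeomorph.subLeft x)
  rw [convolution_eq_swap]
  have h2 := hdiv _ hγ hγc
  simp only [hd, integral_neg, neg_inj] at h2
  simp only [ContinuousLinearMap.lsmul_apply, smul_eq_mul, mul_comm (ρ _), ← h2]
  simp only [fderiv_convolution_apply hρ hρc (hXi _)]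
  rw [← integral_finsetSum]
  · refine integral_congr_ae (Eventually.of_forall fun t => ?_)
    have h3 := (EuclideanSpace.basisFun (Fin ℓ) ℝ).sum_repr (X t)
    dsimp only
    conv_rhs => rw [← h3, _root_.map_sum]
    simp
  · intro i _
    refine Continuous.integrable_of_hasCompactSupport (by fun_prop) ?_
    refine HasCompactSupport.mul_left (f' := fun t => fderiv ℝ ρ (x - t) _) ?_
    exact hdcs.comp_left (g := fun T : 𝔼 →L[ℝ] ℝ => T _) (by simp)

/-- Integration by parts against a continuous compactly supported vector field with continuous
distributional divergence. -/
theorem IsL2WeakGradient.integral_mul_div {Ω : Set 𝔼} (hΩ : IsOpen Ω) {u : 𝔼 → ℝ} {g : 𝔼 → 𝔼}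
    (hg : IsL2WeakGradient Ω u g) (hu : IntegrableOn u Ω) (hgi : IntegrableOn g Ω)
    {X : 𝔼 → 𝔼} {h : 𝔼 → ℝ} (hX : Continuous X) (hXc : HasCompactSupport X)
    (hXΩ : tsupport X ⊆ Ω) (hh : Continuous h) (hhc : HasCompactSupport h)
    (hdiv : ∀ γ : 𝔼 → ℝ, ContDiff ℝ ∞ γ → HasCompactSupport γ →
      ∫ x, fderiv ℝ γ x (X x) = - ∫ x, h x * γ x) :
    ∫ x in Ω, u x * h x = - ∫ x in Ω, inner ℝ (g x) (X x) := by
  have hXi : ∀ i, Continuous fun t => X t i := fun i => by fun_prop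
  have hXic : ∀ i, HasCompactSupport fun t => X t i := fun i =>
    hXc.comp_left (g := fun y : 𝔼 => y i) rfl
  have hgii : ∀ i, IntegrableOn (fun x => g x i) Ω := fun i =>
    (EuclideanSpace.proj (𝕜 := ℝ) i : 𝔼 →L[ℝ] ℝ).integrable_comp hgi
  have hinner : ∫ x in Ω, inner ℝ (g x) (X x) = ∑ i, ∫ x in Ω, g x i * X x i := by
    rw [← integral_finsetSum]
    · simp [PiLp.inner_apply, mul_comm]
    · exact fun i _ => integrable_mul_of_hasCompactSupport (hgii i) (hXi i) (hXic i)
  rw [hinner, ← sub_eq_zero, sub_neg_eq_add]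
  -- Each uniform error `ε` is multiplied by an `L¹` norm of `u` or of a component of `g`; `C` is
  -- their sum.
  set C : ℝ := (∫ x in Ω, ‖u x‖) + ∑ i, ∫ x in Ω, ‖g x i‖ with hC
  suffices H : ∀ ε > 0, |(∫ x in Ω, u x * h x) + ∑ i, ∫ x in Ω, g x i * X x i| ≤ ε * C by
    by_contra hne
    have hpos := abs_pos.2 hne
    have hC0 : 0 ≤ C := by positivity
    have h1 := H (|(∫ x in Ω, u x * h x) + ∑ i, ∫ x in Ω, g x i * X x i| / (2 * (C + 1)))
      (by positivity)
    rw [div_mul_eq_mul_div, le_div_iff₀ (by positivity)] at h1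
    nlinarith
  intro ε hε
  -- The radius `δ₀` keeps the mollified field supported in `Ω`; `δ₁` and `δ₂` keep the
  -- mollifications within `ε` of `h` and `X`.
  obtain ⟨δ₀, hδ₀, hδΩ⟩ := hXc.isCompact.exists_cthickening_subset_open hΩ hXΩ
  obtain ⟨δ₁, hδ₁, huc₁⟩ := Metric.uniformContinuous_iff.1
    (hhc.uniformContinuous_of_continuous hh) ε hε
  obtain ⟨δ₂, hδ₂, huc₂⟩ := Metric.uniformContinuous_iff.1
    (hXc.uniformContinuous_of_continuous hX) ε hε
  set δ := min δ₀ (min δ₁ δ₂) with hδ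
  have hδpos : 0 < δ := by positivity
  let η : ContDiffBump (0 : 𝔼) := ⟨δ / 2, δ, by positivity, by linarith⟩
  set ρ : 𝔼 → ℝ := η.normed volume with hρdef
  have hρ : ContDiff ℝ ∞ ρ := η.contDiff_normed
  have hρc : HasCompactSupport ρ := η.hasCompactSupport_normed
  set Y : Fin ℓ → 𝔼 → ℝ := fun i =>
    convolution ρ (fun t => X t i) (ContinuousLinearMap.lsmul ℝ ℝ) volume with hY
  set k : 𝔼 → ℝ := convolution ρ h (ContinuousLinearMap.lsmul ℝ ℝ) volume with hk
  have hYs : ∀ i, ContDiff ℝ ∞ (Y i) := fun i =>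
    hρc.contDiff_convolution_left _ hρ (hXi i).locallyIntegrable
  have hYc : ∀ i, HasCompactSupport (Y i) := fun i => hρc.convolution _ (hXic i)
  have hks : Continuous k :=
    (hρc.contDiff_convolution_left (n := 0) _ (hρ.of_le (by exact_mod_cast zero_le))
      hh.locallyIntegrable).continuous
  have hkc : HasCompactSupport k := hρc.convolution _ hhc
  have hYΩ : ∀ i, tsupport (Y i) ⊆ Ω := by
    intro i
    refine (closure_minimal ?_ Metric.isClosed_cthickening).trans hδΩ
    refine (support_convolution_subset_swap _).trans ?_
    rintro _ ⟨a, ha, b, hb, rfl⟩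
    have hb' : b ∈ Metric.ball (0 : 𝔼) δ := by
      rw [hρdef, η.support_normed_eq] at hb
      exact hb
    have ha' : a ∈ tsupport X := subset_tsupport _ fun h0 => ha (by simp [h0])
    refine Metric.mem_cthickening_of_dist_le _ a _ _ ha' ?_
    have : ‖b‖ < δ := by simpa using hb'
    simpa using this.le.trans (min_le_left _ _)
  have hkh : ∀ x, |k x - h x| ≤ ε := fun x => by
    rw [← Real.dist_eq]
    refine η.dist_normed_convolution_le hh.aestronglyMeasurable fun y hy => ?_
    exact (huc₁ (lt_of_lt_of_le (Metric.mem_ball.1 hy)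
      ((min_le_right _ _).trans (min_le_left _ _)))).le
  have hYX : ∀ i x, |Y i x - X x i| ≤ ε := fun i x => by
    rw [← Real.dist_eq]
    refine η.dist_normed_convolution_le (g := fun t => X t i) (hXi i).aestronglyMeasurable
      fun y hy => ?_
    have h1 := (huc₂ (lt_of_lt_of_le (Metric.mem_ball.1 hy)
      ((min_le_right _ _).trans (min_le_right _ _)))).le
    refine le_trans ?_ h1
    rw [dist_eq_norm, dist_eq_norm]
    simpa using PiLp.norm_apply_le (X y - X x) i
  have hdY : ∀ x, k x = ∑ i, fderiv ℝ (Y i) x (EuclideanSpace.basisFun (Fin ℓ) ℝ i) := fun x =>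
    (sum_fderiv_convolution_eq hX hdiv hρ hρc x).symm
  have hdYc : ∀ i (v : 𝔼), Continuous fun x => fderiv ℝ (Y i) x v := fun i v =>
    ((hYs i).continuous_fderiv (by simp)).clm_apply continuous_const
  have hdYcs : ∀ i (v : 𝔼), HasCompactSupport fun x => fderiv ℝ (Y i) x v := fun i v =>
    ((hYc i).fderiv ℝ).comp_left (g := fun T : 𝔼 →L[ℝ] ℝ => T v) (by simp)
  -- Each `Y i` is an admissible test function, and `k` is the divergence of `Y`.
  have hmain : ∫ x in Ω, u x * k x = - ∑ i, ∫ x in Ω, g x i * Y i x := by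
    simp only [hdY, Finset.mul_sum]
    rw [integral_finsetSum, ← Finset.sum_neg_distrib]
    · refine Finset.sum_congr rfl fun i _ => ?_
      rw [hg.2 (Y i) (hYs i) (hYc i) (hYΩ i)]
      congr 1
      refine integral_congr_ae (Eventually.of_forall fun x => ?_)
      simp [EuclideanSpace.inner_single_right, mul_comm]
    · exact fun i _ => integrable_mul_of_hasCompactSupport hu (hdYc i _) (hdYcs i _)
  have key : ∀ {w a b : 𝔼 → ℝ}, IntegrableOn w Ω → Continuous a → HasCompactSupport a →
      Continuous b → HasCompactSupport b → (∀ x, |a x - b x| ≤ ε) →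
      |(∫ x in Ω, w x * b x) - ∫ x in Ω, w x * a x| ≤ ε * ∫ x in Ω, ‖w x‖ := by
    intro w a b hw ha hac hb hbc hab
    rw [← integral_sub (integrable_mul_of_hasCompactSupport hw hb hbc)
      (integrable_mul_of_hasCompactSupport hw ha hac), ← integral_const_mul, ← Real.norm_eq_abs]
    refine norm_integral_le_of_norm_le (hw.norm.const_mul ε) (Eventually.of_forall fun x => ?_)
    rw [← mul_sub, norm_mul, mul_comm]
    gcongr
    rw [Real.norm_eq_abs, abs_sub_comm]
    exact hab x
  have h1 := key hu hks hkc hh hhc hkh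
  have h2 : |(∑ i, ∫ x in Ω, g x i * X x i) - ∑ i, ∫ x in Ω, g x i * Y i x| ≤
      ε * ∑ i, ∫ x in Ω, ‖g x i‖ := by
    rw [← Finset.sum_sub_distrib, Finset.mul_sum]
    exact (Finset.abs_sum_le_sum_abs _ _).trans (Finset.sum_le_sum fun i _ =>
      key (hgii i) (hYs i).continuous (hYc i) (hXi i) (hXic i) (hYX i))
  rw [hmain] at h1
  rw [hC, mul_add]
  calc _ = |((∫ x in Ω, u x * h x) - -∑ i, ∫ x in Ω, g x i * Y i x) +
        ((∑ i, ∫ x in Ω, g x i * X x i) - ∑ i, ∫ x in Ω, g x i * Y i x)| := by ring_nf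
    _ ≤ _ := (abs_add_le _ _).trans (add_le_add h1 h2)

end WeakGradient

/-! ### Translation invariance from a vanishing weak derivative -/

section Translation

/-- The translation is carried by `ζ`, since `f` is merely integrable; a global bound on the
derivative of `ζ` provides the dominating function. -/
theorem hasDerivAt_integral_mul_translate {H : Type*} [NormedAddCommGroup H] [NormedSpace ℝ H]
    [MeasurableSpace H] [BorelSpace H] {μ : Measure H} {f ζ : H → ℝ} (hf : Integrable f μ)
    (hζ : ContDiff ℝ ∞ ζ) (hζc : HasCompactSupport ζ) (v : H) (t : ℝ) :
    HasDerivAt (fun t : ℝ => ∫ z, f z * ζ (z - t • v) ∂μ)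
      (∫ z, f z * -fderiv ℝ ζ (z - t • v) v ∂μ) t := by
  obtain ⟨C, hC⟩ := (hζc.fderiv ℝ).exists_bound_of_continuous
    (hζ.continuous_fderiv (by simp))
  have hcont : ∀ t : ℝ, Continuous fun z => ζ (z - t • v) := fun t =>
    hζ.continuous.comp (by fun_prop)
  have hcd : ∀ t : ℝ, Continuous fun z => -fderiv ℝ ζ (z - t • v) v := fun t =>
    (((hζ.continuous_fderiv (by simp)).comp (by fun_prop : Continuous fun z => z - t • v)).clm_apply
      continuous_const).neg
  refine (hasDerivAt_integral_of_dominated_loc_of_deriv_le (s := univ)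
    (F' := fun (t : ℝ) z => f z * -fderiv ℝ ζ (z - t • v) v)
    (bound := fun z => ‖f z‖ * (C * ‖v‖)) univ_mem ?_ ?_ ?_ ?_ ?_ ?_).2
  · exact Eventually.of_forall fun t => hf.1.mul (hcont t).aestronglyMeasurable
  · exact integrable_mul_of_hasCompactSupport hf (hcont t)
      (hζc.comp_homeomorph (Homeomorph.subRight (t • v)))
  · exact hf.1.mul (hcd t).aestronglyMeasurable
  · refine Eventually.of_forall fun z s _ => ?_
    rw [norm_mul, norm_neg]
    gcongr
    exact ((fderiv ℝ ζ (z - s • v)).le_opNorm v).trans (by gcongr; exact hC _)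
  · exact hf.norm.mul_const _
  · refine Eventually.of_forall fun z s _ => ?_
    have h1 : HasDerivAt (fun s : ℝ => z - s • v) (-v) s := by
      simpa using ((hasDerivAt_id s).smul_const v).const_sub z
    have h2 := ((hζ.differentiable (by simp)).differentiableAt.hasFDerivAt
      (x := z - s • v)).comp_hasDerivAt s h1
    simpa using h2.const_mul (f z)

variable {H : Type*} [NormedAddCommGroup H] [NormedSpace ℝ H] [FiniteDimensional ℝ H]
  [MeasurableSpace H] [BorelSpace H] {μ : Measure H} [μ.IsAddHaarMeasure]

/-- A function whose weak derivative in direction `v` vanishes on a convex open set is invariant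
under translation by `v` as long as one stays in the set. -/
theorem ae_eq_translate_of_integral_fderiv_eq_zero {f : H → ℝ} (hf : Integrable f μ) {B : Set H}
    (hB : IsOpen B) (hBc : Convex ℝ B) (v : H)
    (hz : ∀ ζ : H → ℝ, ContDiff ℝ ∞ ζ → HasCompactSupport ζ → tsupport ζ ⊆ B →
      ∫ z, f z * fderiv ℝ ζ z v ∂μ = 0) :
    ∀ᵐ z ∂μ, z ∈ B → z + v ∈ B → f z = f (z + v) := by
  have hB' : IsOpen (B ∩ (fun z => z + v) ⁻¹' B) := hB.inter (hB.preimage (by fun_prop))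
  have hfv : Integrable (fun z => f (z + v)) μ := hf.comp_add_right v
  have key := hB'.ae_eq_zero_of_integral_contDiff_smul_eq_zero (μ := μ)
    (f := fun z => f z - f (z + v)) ((hf.sub hfv).locallyIntegrable.locallyIntegrableOn _) ?_
  · filter_upwards [key] with z hz h1 h2
    exact sub_eq_zero.1 (hz ⟨h1, h2⟩)
  intro ζ hζ hζc hζB
  -- The derivative in `t` is a pairing of `f` with the derivative of the translated test function,
  -- which is again admissible.
  have hconst : ∀ t ∈ Icc (0 : ℝ) 1,
      ∫ z, f z * ζ (z - t • v) ∂μ = ∫ z, f z * ζ (z - (0 : ℝ) • v) ∂μ := by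
    refine constant_of_has_deriv_right_zero
      (fun t _ => (hasDerivAt_integral_mul_translate hf hζ hζc v t).continuousAt.continuousWithinAt)
      fun t ht => ?_
    have h1 := hasDerivAt_integral_mul_translate hf hζ hζc v t
    have hcd : ContDiff ℝ ∞ fun z => ζ (z - t • v) := hζ.comp (by fun_prop)
    have h2 := hz _ hcd (hζc.comp_homeomorph (Homeomorph.subRight (t • v))) ?_
    · have h3 : ∀ z, fderiv ℝ (fun z => ζ (z - t • v)) z v = fderiv ℝ ζ (z - t • v) v := by
        intro z
        simp only [sub_eq_add_neg]
        rw [fderiv_comp_add_right]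
      simp only [h3] at h2
      simp only [mul_neg, integral_neg, h2, neg_zero] at h1
      exact h1.hasDerivWithinAt
    · intro z hzt
      have h4 : z - t • v ∈ tsupport ζ :=
        tsupport_comp_subset_preimage ζ (f := fun z => z - t • v) (by fun_prop) hzt
      obtain ⟨h5, h6⟩ := hζB h4
      -- The point `z` divides the segment from `z - t • v` to `z - t • v + v` in the ratio `t : 1 -
      -- t`.
      have h7 := hBc h5 h6 (sub_nonneg.2 ht.2.le) ht.1 (by ring)
      convert h7 using 1
      module
  have h1 := hconst 1 (by simp)
  simp only [one_smul, zero_smul, sub_zero] at h1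
  have h2 : ∫ z, f z * ζ (z - v) ∂μ = ∫ z, f (z + v) * ζ z ∂μ := by
    rw [← integral_add_right_eq_self _ v]
    simp
  simp only [smul_eq_mul, mul_sub]
  rw [integral_sub]
  · simp only [mul_comm (ζ _)]
    rw [← h2, h1, sub_self]
  · simpa only [mul_comm] using integrable_mul_of_hasCompactSupport hf hζ.continuous hζc
  · simpa only [mul_comm] using integrable_mul_of_hasCompactSupport hfv hζ.continuous hζc

end Translation

/-! ### Functions on a box that are constant in the second factor -/

section Box

variable {k m : ℕ}

local notation "𝔽" => EuclideanSpace ℝ (Fin k)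
local notation "𝔾" => EuclideanSpace ℝ (Fin m)

instance : (volume : Measure (𝔽 × 𝔾)).IsAddHaarMeasure :=
  inferInstanceAs ((volume : Measure 𝔽).prod (volume : Measure 𝔾)).IsAddHaarMeasure

/-- A function on a box whose weak derivatives in the directions of the second factor vanish
depends, up to null sets, on the first variable only. -/
theorem ae_exists_ae_eq_const {f : 𝔽 × 𝔾 → ℝ} {y₀ : 𝔽} {n₀ : 𝔾} {ρ : ℝ}
    (hf : IntegrableOn f (Metric.ball (y₀, n₀) ρ))
    (hz : ∀ ζ : 𝔽 × 𝔾 → ℝ, ContDiff ℝ ∞ ζ → HasCompactSupport ζ →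
      tsupport ζ ⊆ Metric.ball (y₀, n₀) ρ → ∀ w : 𝔾,
        ∫ z in Metric.ball (y₀, n₀) ρ, f z * fderiv ℝ ζ z (0, w) = 0) :
    ∀ᵐ y : 𝔽, y ∈ Metric.ball y₀ ρ →
      ∃ c, ∀ᵐ n : 𝔾, n ∈ Metric.ball n₀ ρ → f (y, n) = c := by
  rcases le_or_gt ρ 0 with hρ | hρ
  · simp [Metric.ball_eq_empty.2 hρ]
  set B : Set (𝔽 × 𝔾) := Metric.ball (y₀, n₀) ρ with hBdef
  have hB : IsOpen B := Metric.isOpen_ball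
  have hBc : Convex ℝ B := convex_ball _ _
  have hmem : ∀ y n, (y, n) ∈ B ↔ y ∈ Metric.ball y₀ ρ ∧ n ∈ Metric.ball n₀ ρ := fun y n => by
    rw [hBdef, ← ball_prod_same, mem_prod]
  have hf0 : Integrable (B.indicator f) (volume : Measure (𝔽 × 𝔾)) :=
    (integrable_indicator_iff hB.measurableSet).2 hf
  -- A measurable representative makes the invariance set measurable, so that Fubini turns `∀ w, ∀ᵐ
  -- z` into `∀ᵐ z, ∀ᵐ w`.
  set f₁ := hf0.1.mk with hf₁def
  have hf₁m : StronglyMeasurable f₁ := hf0.1.stronglyMeasurable_mk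
  have hae : B.indicator f =ᵐ[volume] f₁ := hf0.1.ae_eq_mk
  have hf₁ : Integrable f₁ (volume : Measure (𝔽 × 𝔾)) := hf0.congr hae
  have hinv : ∀ w : 𝔾, ∀ᵐ z : 𝔽 × 𝔾, z ∈ B → z + (0, w) ∈ B → f₁ z = f₁ (z + (0, w)) := by
    intro w
    refine ae_eq_translate_of_integral_fderiv_eq_zero hf₁ hB hBc _ fun ζ hζ hζc hζB => ?_
    rw [← hz ζ hζ hζc hζB w, ← integral_indicator hB.measurableSet]
    refine integral_congr_ae ?_
    filter_upwards [hae] with z h1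
    rw [← h1]
    by_cases h2 : z ∈ B <;> simp [h2]
  have hswap : ∀ᵐ z : 𝔽 × 𝔾, ∀ᵐ w : 𝔾, z ∈ B → z + (0, w) ∈ B → f₁ z = f₁ (z + (0, w)) := by
    have hmeas : MeasurableSet {p : 𝔾 × (𝔽 × 𝔾) | p.2 ∈ B → p.2 + (0, p.1) ∈ B →
        f₁ p.2 = f₁ (p.2 + (0, p.1))} := by
      have hadd : Measurable fun p : 𝔾 × (𝔽 × 𝔾) => p.2 + (0, p.1) := by fun_prop
      have m1 : MeasurableSet {p : 𝔾 × (𝔽 × 𝔾) | p.2 ∈ B} := measurable_snd hB.measurableSet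
      have m2 : MeasurableSet {p : 𝔾 × (𝔽 × 𝔾) | p.2 + (0, p.1) ∈ B} := hadd hB.measurableSet
      have m3 : MeasurableSet {p : 𝔾 × (𝔽 × 𝔾) | f₁ p.2 = f₁ (p.2 + (0, p.1))} :=
        measurableSet_eq_fun (hf₁m.measurable.comp measurable_snd) (hf₁m.measurable.comp hadd)
      exact m1.imp (m2.imp m3)
    have h1 : ∀ᵐ p ∂((volume : Measure 𝔾).prod (volume : Measure (𝔽 × 𝔾))), p.2 ∈ B →
        p.2 + (0, p.1) ∈ B → f₁ p.2 = f₁ (p.2 + (0, p.1)) :=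
      (ae_prod_iff_ae_ae hmeas).2 (Eventually.of_forall hinv)
    have h2 := (measurePreserving_swap (μ := (volume : Measure (𝔽 × 𝔾)))
      (ν := (volume : Measure 𝔾))).quasiMeasurePreserving.ae h1
    exact ae_ae_of_ae_prod h2
  have h3 := ae_ae_of_ae_prod (μ := (volume : Measure 𝔽)) (ν := (volume : Measure 𝔾)) hswap
  have h4 := ae_ae_of_ae_prod (μ := (volume : Measure 𝔽)) (ν := (volume : Measure 𝔾)) hae
  filter_upwards [h3, h4] with y h5 h6 hy
  -- One good base point on the plaque suffices: almost every other point is its translate by an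
  -- admissible `w`.
  obtain ⟨n, hn, h7⟩ : ∃ n ∈ Metric.ball n₀ ρ, ∀ᵐ w : 𝔾, (y, n) ∈ B → (y, n) + (0, w) ∈ B →
      f₁ (y, n) = f₁ ((y, n) + (0, w)) := by
    have hpos : volume (Metric.ball n₀ ρ) ≠ 0 := (Metric.measure_ball_pos _ _ hρ).ne'
    have := (frequently_ae_mem_iff.2 hpos).and_eventually h5
    exact this.exists
  refine ⟨f₁ (y, n), ?_⟩
  have h8 : ∀ᵐ n' : 𝔾, (y, n) ∈ B → (y, n) + (0, n' - n) ∈ B →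
      f₁ (y, n) = f₁ ((y, n) + (0, n' - n)) :=
    (measurePreserving_sub_right (volume : Measure 𝔾) n).quasiMeasurePreserving.ae h7
  filter_upwards [h8, h6] with n' h9 h10 hn'
  have h11 : (y, n') ∈ B := (hmem _ _).2 ⟨hy, hn'⟩
  have h12 : (y, n) + (0, n' - n) = (y, n') := by simp
  rw [h12] at h9
  rw [h9 ((hmem _ _).2 ⟨hy, hn⟩) h11, ← h10, indicator_of_mem h11]

end Box

/-! ### Tangent spaces, local coordinates and fiber charts -/

section Geometry

variable {ℓ k r : ℕ} {M U Ω : Set (EuclideanSpace ℝ (Fin ℓ))}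
  {φ : EuclideanSpace ℝ (Fin ℓ) → EuclideanSpace ℝ (Fin ℓ)}

local notation "𝔼" => EuclideanSpace ℝ (Fin ℓ)
local notation "𝔽" => EuclideanSpace ℝ (Fin k)
local notation "𝔾" => EuclideanSpace ℝ (Fin (ℓ - k))

/-- In a straightening chart the tangent space is the range of the derivative of the induced
parametrization, and this derivative is injective. -/
theorem tangentSpaceAt_eq_range {Ψ : OpenPartialHomeomorph 𝔼 (𝔽 × 𝔾)}
    (hΨ : ContDiffOn ℝ 1 Ψ Ψ.source) (hΨs : ContDiffOn ℝ 1 Ψ.symm Ψ.target)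
    (hΨM : ∀ x ∈ Ψ.source, x ∈ M ↔ (Ψ x).2 = 0) {y : 𝔽} (hy : (y, (0 : 𝔾)) ∈ Ψ.target) :
    tangentSpaceAt M (Ψ.symm (y, 0)) =
        LinearMap.range (fderiv ℝ (fun y : 𝔽 => Ψ.symm (y, (0 : 𝔾))) y).toLinearMap ∧
      Function.Injective (fderiv ℝ (fun y : 𝔽 => Ψ.symm (y, (0 : 𝔾))) y) := by
  set ψ : 𝔽 → 𝔼 := fun y => Ψ.symm (y, (0 : 𝔾)) with hψ
  have hd1 : DifferentiableAt ℝ ψ y :=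
    ((hΨs.contDiffAt (Ψ.open_target.mem_nhds hy)).differentiableAt one_ne_zero).comp y
      (by fun_prop : DifferentiableAt ℝ (fun y : 𝔽 => (y, (0 : 𝔾))) y)
  have hps : ψ y ∈ Ψ.source := Ψ.map_target hy
  have hd2 : DifferentiableAt ℝ (fun x => (Ψ x).1) (ψ y) :=
    ((hΨ.contDiffAt (Ψ.open_source.mem_nhds hps)).differentiableAt one_ne_zero).fst
  have hev : ∀ᶠ y' in 𝓝 y, (y', (0 : 𝔾)) ∈ Ψ.target :=
    (by fun_prop : Continuous fun y' : 𝔽 => (y', (0 : 𝔾))).continuousAt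
      (Ψ.open_target.mem_nhds hy)
  have hχψ : ∀ y' : 𝔽, (y', (0 : 𝔾)) ∈ Ψ.target → (Ψ (ψ y')).1 = y' := fun y' h => by
    simp only [hψ]
    rw [Ψ.right_inv h]
  refine ⟨le_antisymm (Submodule.span_le.2 ?_) ?_, ?_⟩
  · rintro v ⟨γ, hγ0, hγM, hγ⟩
    replace hγ0 : γ 0 = ψ y := hγ0
    have hcont : Tendsto γ (𝓝 0) (𝓝 (ψ y)) := by
      have := hγ.continuousAt.tendsto
      rwa [hγ0] at this
    -- A curve in `M` factors through the parametrization near time `0`, so its velocity lies in the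
    -- range of `Dψ`.
    have h1 : ∀ᶠ t in 𝓝 0, γ t = ψ ((Ψ (γ t)).1) := by
      filter_upwards [hγM, hcont (Ψ.open_source.mem_nhds hps)] with t h2 h3
      have h4 : Ψ (γ t) = ((Ψ (γ t)).1, 0) := Prod.ext rfl ((hΨM _ h3).1 h2)
      change γ t = Ψ.symm ((Ψ (γ t)).1, 0)
      rw [← h4, Ψ.left_inv h3]
    have hγ2 : HasDerivAt (fun t => (Ψ (γ t)).1) (fderiv ℝ (fun x => (Ψ x).1) (ψ y) v) 0 := by
      have hd3 := hd2.hasFDerivAt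
      rw [← hγ0] at hd3
      have := hd3.comp_hasDerivAt (0 : ℝ) hγ
      rwa [hγ0] at this
    have hy0 : (Ψ (γ 0)).1 = y := by rw [hγ0]; exact hχψ y hy
    have hd4 := hd1.hasFDerivAt
    have h5 : HasDerivAt (fun t => ψ ((Ψ (γ t)).1))
        (fderiv ℝ ψ y (fderiv ℝ (fun x => (Ψ x).1) (ψ y) v)) 0 := by
      rw [← hy0] at hd4
      have := hd4.comp_hasDerivAt (0 : ℝ) hγ2
      rwa [hy0] at this
    exact ⟨_, h5.unique (hγ.congr_of_eventuallyEq (h1.mono fun t ht => ht.symm))⟩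
  · rintro _ ⟨e, rfl⟩
    refine Submodule.subset_span ⟨fun t => ψ (y + t • e), by simp [hψ], ?_, ?_⟩
    · have hc : Tendsto (fun t : ℝ => y + t • e) (𝓝 0) (𝓝 y) := by
        have : Continuous fun t : ℝ => y + t • e := by fun_prop
        simpa using this.tendsto 0
      filter_upwards [hc hev] with t ht
      refine (hΨM _ (Ψ.map_target ht)).2 ?_
      rw [Ψ.right_inv ht]
    · have h1 : HasDerivAt (fun t : ℝ => y + t • e) e 0 := by
        simpa using ((hasDerivAt_id (0 : ℝ)).smul_const e).const_add y
      have h2 : HasFDerivAt ψ (fderiv ℝ ψ y) (y + (0 : ℝ) • e) := by simpa using hd1.hasFDerivAt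
      exact h2.comp_hasDerivAt (0 : ℝ) h1
  · have h1 : HasFDerivAt (fun y' => (Ψ (ψ y')).1)
        ((fderiv ℝ (fun x => (Ψ x).1) (ψ y)).comp (fderiv ℝ ψ y)) y :=
      hd2.hasFDerivAt.comp y hd1.hasFDerivAt
    have h2 := h1.unique ((hasFDerivAt_id y).congr_of_eventuallyEq (hev.mono hχψ))
    refine Function.LeftInverse.injective (g := fderiv ℝ (fun x => (Ψ x).1) (ψ y)) fun e => ?_
    exact congrArg (fun T : 𝔽 →L[ℝ] 𝔽 => T e) h2

/-- If `x - ψ (κ x)` is orthogonal to the range of `Dψ (κ x)` near `x₀`, then the kernel of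
`Dκ x₀` is orthogonal to the range of `Dψ (κ x₀)`. -/
theorem inner_fderiv_eq_zero_of_fderiv_eq_zero {E F : Type*} [NormedAddCommGroup E]
    [InnerProductSpace ℝ E] [NormedAddCommGroup F] [NormedSpace ℝ F] {κ : E → F} {ψ : F → E}
    {x₀ : E} (hκ : DifferentiableAt ℝ κ x₀) (hψ : ContDiffAt ℝ 2 ψ (κ x₀))
    (hort : ∀ᶠ x in 𝓝 x₀, ∀ e, inner ℝ (fderiv ℝ ψ (κ x) e) (x - ψ (κ x)) = 0) {v : E}
    (hv : fderiv ℝ κ x₀ v = 0) (e : F) : inner ℝ (fderiv ℝ ψ (κ x₀) e) v = 0 := by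
  have h1 : DifferentiableAt ℝ (fderiv ℝ ψ) (κ x₀) :=
    (hψ.fderiv_right (m := 1) (by norm_num)).differentiableAt one_ne_zero
  have h2 : HasFDerivAt (fun x => fderiv ℝ ψ (κ x) e)
      ((ContinuousLinearMap.apply ℝ E e).comp ((fderiv ℝ (fderiv ℝ ψ) (κ x₀)).comp
        (fderiv ℝ κ x₀))) x₀ :=
    (ContinuousLinearMap.apply ℝ E e).hasFDerivAt.comp x₀ (h1.hasFDerivAt.comp x₀ hκ.hasFDerivAt)
  have h3 : HasFDerivAt (fun x => x - ψ (κ x))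
      (ContinuousLinearMap.id ℝ E - (fderiv ℝ ψ (κ x₀)).comp (fderiv ℝ κ x₀)) x₀ :=
    (hasFDerivAt_id x₀).sub
      ((hψ.differentiableAt two_ne_zero).hasFDerivAt.comp x₀ hκ.hasFDerivAt)
  have h4 := (h2.inner ℝ h3).unique
    ((hasFDerivAt_const (0 : ℝ) x₀).congr_of_eventuallyEq (hort.mono fun x hx => hx e))
  -- Every term of the product rule containing `Dκ` dies on `v`; only the derivative of the bare `x`
  -- survives.
  have h5 := congrArg (fun T : E →L[ℝ] ℝ => T v) h4
  simpa [hv] using h5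

/-- The local coordinate `κ` of `φ` in `M`; its level sets are those of `φ` and the kernel of its
derivative is the normal space. -/
theorem exists_local_coordinate (hr : 2 ≤ r) (hM : IsImbeddedSubmanifold r k M)
    (hφ : IsTubularProjection r M U φ) {x₀ : 𝔼} (hx₀ : x₀ ∈ U) :
    ∃ (W : Set 𝔼) (κ : 𝔼 → 𝔽) (ψ : 𝔽 → 𝔼) (χ : 𝔼 → 𝔽), IsOpen W ∧ x₀ ∈ W ∧ W ⊆ U ∧
      ContDiffOn ℝ 1 κ W ∧ (∀ x ∈ W, ψ (κ x) = φ x) ∧ (∀ x ∈ W, χ (φ x) = κ x) ∧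
      ContDiffAt ℝ 1 ψ (κ x₀) ∧ ContDiffAt ℝ 1 χ (φ x₀) ∧
      Module.finrank ℝ (LinearMap.ker (fderiv ℝ κ x₀).toLinearMap) = ℓ - k ∧
      ∀ x ∈ W, ∀ v, fderiv ℝ κ x v = 0 ↔ v ∈ (tangentSpaceAt M (φ x))ᗮ := by
  obtain ⟨Ψ, hp, hΨ, hΨs, hΨM⟩ := hM _ (hφ.mapsTo hx₀)
  have hr2 : (2 : WithTop ℕ∞) ≤ (r : WithTop ℕ∞) := by exact_mod_cast hr
  have hr1 : (1 : WithTop ℕ∞) ≤ (r : WithTop ℕ∞) := by exact_mod_cast (by omega : 1 ≤ r)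
  have hφ1 : ContDiffOn ℝ 1 φ U :=
    hφ.contDiffOn.of_le (by exact_mod_cast (by omega : 1 ≤ r - 1))
  have hΨ1 : ContDiffOn ℝ 1 Ψ Ψ.source := hΨ.of_le hr1
  set W : Set 𝔼 := U ∩ φ ⁻¹' Ψ.source with hW
  have hWo : IsOpen W := hφ1.continuousOn.isOpen_inter_preimage hφ.isOpen Ψ.open_source
  set κ : 𝔼 → 𝔽 := fun x => (Ψ (φ x)).1 with hκ
  set ψ : 𝔽 → 𝔼 := fun y => Ψ.symm (y, (0 : 𝔾)) with hψ
  have hΨφ : ∀ x ∈ W, Ψ (φ x) = (κ x, 0) := fun x hx =>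
    Prod.ext rfl ((hΨM _ hx.2).1 (hφ.mapsTo hx.1))
  have hψκ : ∀ x ∈ W, ψ (κ x) = φ x := fun x hx => by
    change Ψ.symm (κ x, 0) = φ x
    rw [← hΨφ x hx, Ψ.left_inv hx.2]
  have hκt : ∀ x ∈ W, (κ x, (0 : 𝔾)) ∈ Ψ.target := fun x hx => by
    rw [← hΨφ x hx]
    exact Ψ.map_source hx.2
  have hκ1 : ContDiffOn ℝ 1 κ W :=
    contDiff_fst.comp_contDiffOn (hΨ1.comp (hφ1.mono inter_subset_left) fun x hx => hx.2)
  -- Two derivatives of `ψ` are needed, as its derivative is differentiated once more; this uses `2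
  -- ≤ r`.
  have hψ2 : ∀ x ∈ W, ContDiffAt ℝ 2 ψ (κ x) := fun x hx =>
    ((hΨs.contDiffAt (Ψ.open_target.mem_nhds (hκt x hx))).of_le hr2).comp (κ x)
      (by fun_prop : ContDiffAt ℝ 2 (fun y : 𝔽 => (y, (0 : 𝔾))) (κ x))
  have hx₀W : x₀ ∈ W := ⟨hx₀, hp⟩
  have hT : ∀ x ∈ W, tangentSpaceAt M (φ x) = LinearMap.range (fderiv ℝ ψ (κ x)).toLinearMap ∧
      Function.Injective (fderiv ℝ ψ (κ x)) := fun x hx => by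
    have := tangentSpaceAt_eq_range (M := M) hΨ1 (hΨs.of_le hr1) hΨM (hκt x hx)
    rwa [show Ψ.symm (κ x, 0) = φ x from hψκ x hx] at this
  have heq : ∀ x ∈ W, LinearMap.ker (fderiv ℝ κ x).toLinearMap = (tangentSpaceAt M (φ x))ᗮ ∧
      Module.finrank ℝ (LinearMap.ker (fderiv ℝ κ x).toLinearMap) = ℓ - k := by
    intro x hx
    obtain ⟨hTx, hinj⟩ := hT x hx
    have hle : LinearMap.ker (fderiv ℝ κ x).toLinearMap ≤ (tangentSpaceAt M (φ x))ᗮ := by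
      intro v hv
      rw [Submodule.mem_orthogonal, hTx]
      rintro _ ⟨e, rfl⟩
      refine inner_fderiv_eq_zero_of_fderiv_eq_zero
        ((hκ1.contDiffAt (hWo.mem_nhds hx)).differentiableAt one_ne_zero) (hψ2 x hx) ?_ hv e
      filter_upwards [hWo.mem_nhds hx] with x' hx' e'
      rw [hψκ x' hx']
      refine (Submodule.mem_orthogonal _ _).1 (hφ.normal x' hx'.1) _ ?_
      rw [(hT x' hx').1]
      exact ⟨e', rfl⟩
    -- By rank-nullity the kernel has dimension at least `ℓ - k`, which is the dimension of the
    -- normal space containing it.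
    have hfin1 := (fderiv ℝ κ x).toLinearMap.finrank_range_add_finrank_ker
    have hfin2 := (LinearMap.range (fderiv ℝ κ x).toLinearMap).finrank_le
    have hfin3 := (tangentSpaceAt M (φ x)).finrank_add_finrank_orthogonal
    have hfin4 : Module.finrank ℝ (tangentSpaceAt M (φ x)) = k := by
      rw [hTx, LinearMap.finrank_range_of_inj hinj, finrank_euclideanSpace_fin]
    rw [finrank_euclideanSpace_fin] at hfin1 hfin2 hfin3
    have heq := Submodule.eq_of_le_of_finrank_le hle (by omega)
    exact ⟨heq, by rw [heq]; omega⟩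
  refine ⟨W, κ, ψ, fun x => (Ψ x).1, hWo, hx₀W, inter_subset_left, hκ1, hψκ, fun x _ => rfl,
    (hψ2 x₀ hx₀W).of_le (by norm_num),
    contDiff_fst.contDiffAt.comp _ (hΨ1.contDiffAt (Ψ.open_source.mem_nhds hp)),
    (heq x₀ hx₀W).2, fun x hx v => ?_⟩
  rw [← (heq x hx).1]
  exact LinearMap.mem_ker.symm

end Geometry

/-- A `C¹` chart of a part of `Ω` onto a box, the first component of which is a coordinate of the
value of `φ` in `M`; the parametrization `ψ` and the coordinate `χ` of `M` are mutually inverse on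
the relevant sets. -/
structure FiberChart {ℓ : ℕ} (k m : ℕ) (M Ω : Set (EuclideanSpace ℝ (Fin ℓ)))
    (φ : EuclideanSpace ℝ (Fin ℓ) → EuclideanSpace ℝ (Fin ℓ)) where
  Φ : OpenPartialHomeomorph (EuclideanSpace ℝ (Fin ℓ))
    (EuclideanSpace ℝ (Fin k) × EuclideanSpace ℝ (Fin m))
  y₀ : EuclideanSpace ℝ (Fin k)
  n₀ : EuclideanSpace ℝ (Fin m)
  ρ : ℝ
  ψ : EuclideanSpace ℝ (Fin k) → EuclideanSpace ℝ (Fin ℓ)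
  χ : EuclideanSpace ℝ (Fin ℓ) → EuclideanSpace ℝ (Fin k)
  target_eq : Φ.target = Metric.ball (y₀, n₀) ρ
  source_subset : Φ.source ⊆ Ω
  contDiffOn : ContDiffOn ℝ 1 Φ Φ.source
  contDiffOn_symm : ContDiffOn ℝ 1 Φ.symm Φ.target
  param : ∀ x ∈ Φ.source, ψ (Φ x).1 = φ x
  coord : ∀ x ∈ Φ.source, χ (φ x) = (Φ x).1
  lipschitz : ∃ K, LipschitzOnWith K Φ Φ.source
  lipschitz_symm : ∃ K, LipschitzOnWith K Φ.symm Φ.target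
  lipschitz_param : ∃ K, LipschitzOnWith K ψ (Metric.ball y₀ ρ)
  lipschitz_coord : ∃ K, LipschitzOnWith K χ (φ '' Φ.source)
  ker_eq : ∀ x ∈ Φ.source, ∀ v, (fderiv ℝ Φ x v).1 = 0 ↔ v ∈ (tangentSpaceAt M (φ x))ᗮ

/-- The inverse function theorem applies to `x ↦ (κ x, A x)`, where `A` is the orthogonal projection
onto `ker Dκ x₀` in linear coordinates: a vector killed by `Dκ x₀` is fixed by that projection, so
the derivative is injective. Shrinking to a small ball in the target secures all the Lipschitz
bounds at once. -/
theorem exists_fiberChart {ℓ k r : ℕ} {M U Ω : Set (EuclideanSpace ℝ (Fin ℓ))}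
    {φ : EuclideanSpace ℝ (Fin ℓ) → EuclideanSpace ℝ (Fin ℓ)} (hkℓ : k < ℓ) (hr : 2 ≤ r)
    (hM : IsImbeddedSubmanifold r k M) (hφ : IsTubularProjection r M U φ) (hΩ : IsOpen Ω)
    (hΩU : Ω ⊆ U) {x₀ : EuclideanSpace ℝ (Fin ℓ)} (hx₀ : x₀ ∈ Ω) :
    ∃ c : FiberChart k (ℓ - k) M Ω φ, x₀ ∈ c.Φ.source := by
  obtain ⟨W, κ, ψ, χ, hWo, hx₀W, -, hκ1, hψκ, hχφ, hψ1, hχ1, hVfin, hker⟩ :=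
    exists_local_coordinate hr hM hφ (hΩU hx₀)
  have hκd : ∀ x ∈ W, DifferentiableAt ℝ κ x := fun x hx =>
    (hκ1.contDiffAt (hWo.mem_nhds hx)).differentiableAt one_ne_zero
  set V := LinearMap.ker (fderiv ℝ κ x₀).toLinearMap with hV
  have hVfin' : Module.finrank ℝ V = Module.finrank ℝ (EuclideanSpace ℝ (Fin (ℓ - k))) := by
    rw [hVfin, finrank_euclideanSpace_fin]
  let eV : V ≃L[ℝ] EuclideanSpace ℝ (Fin (ℓ - k)) := ContinuousLinearEquiv.ofFinrankEq hVfin'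
  let A : EuclideanSpace ℝ (Fin ℓ) →L[ℝ] EuclideanSpace ℝ (Fin (ℓ - k)) :=
    (eV : V →L[ℝ] _).comp V.orthogonalProjectionOnto
  set f : EuclideanSpace ℝ (Fin ℓ) → EuclideanSpace ℝ (Fin k) × EuclideanSpace ℝ (Fin (ℓ - k)) :=
    fun x => (κ x, A x) with hf
  have hfd : ∀ x ∈ W, HasFDerivAt f ((fderiv ℝ κ x).prod A) x := fun x hx =>
    (hκd x hx).hasFDerivAt.prodMk A.hasFDerivAt
  have hinj : Function.Injective ((fderiv ℝ κ x₀).prod A) := by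
    rw [injective_iff_map_eq_zero]
    intro v hv
    have h1 : fderiv ℝ κ x₀ v = 0 := congrArg Prod.fst hv
    have h2 : eV (V.orthogonalProjectionOnto v) = 0 := congrArg Prod.snd hv
    have h3 := (map_eq_zero_iff eV eV.injective).1 h2
    have h4 : V.orthogonalProjectionOnto v = ⟨v, h1⟩ :=
      Submodule.orthogonalProjectionOnto_mem_subspace_eq_self (K := V) ⟨v, h1⟩
    rw [h4] at h3
    exact congrArg Subtype.val h3
  let L : EuclideanSpace ℝ (Fin ℓ) ≃L[ℝ]
      EuclideanSpace ℝ (Fin k) × EuclideanSpace ℝ (Fin (ℓ - k)) :=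
    (LinearMap.linearEquivOfInjective ((fderiv ℝ κ x₀).prod A).toLinearMap hinj
      (by simp; omega)).toContinuousLinearEquiv
  have hL : HasFDerivAt f (L : EuclideanSpace ℝ (Fin ℓ) →L[ℝ] _) x₀ := by
    have hLe : (L : EuclideanSpace ℝ (Fin ℓ) →L[ℝ] _) = (fderiv ℝ κ x₀).prod A := by
      ext1 v
      rfl
    rw [hLe]
    exact hfd x₀ hx₀W
  have hf1 : ContDiffAt ℝ 1 f x₀ :=
    (hκ1.contDiffAt (hWo.mem_nhds hx₀W)).prodMk A.contDiff.contDiffAt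
  set P₀ := hf1.toOpenPartialHomeomorph f hL one_ne_zero with hP₀
  set P := P₀.restrContDiff ℝ 1 (by simp) with hP
  have hx₀P : x₀ ∈ P.source := by
    rw [hP, OpenPartialHomeomorph.restrContDiff_source]
    exact ⟨hf1.mem_toOpenPartialHomeomorph_source hL one_ne_zero, hf1,
      hf1.to_localInverse hL one_ne_zero⟩
  have hP1 : ContDiffOn ℝ 1 P P.source := P₀.contDiffOn_restrContDiff_source ℝ (by simp)
  have hP2 : ContDiffOn ℝ 1 P.symm P.target := P₀.contDiffOn_restrContDiff_target ℝ (by simp)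
  have hz₀ : f x₀ ∈ P.target := P.map_source hx₀P
  obtain ⟨K₁, s₁, hs₁, hl₁⟩ := hf1.exists_lipschitzOnWith
  obtain ⟨K₂, s₂, hs₂, hl₂⟩ :=
    (hP2.contDiffAt (P.open_target.mem_nhds hz₀)).exists_lipschitzOnWith
  obtain ⟨K₃, s₃, hs₃, hl₃⟩ := hψ1.exists_lipschitzOnWith
  obtain ⟨K₄, s₄, hs₄, hl₄⟩ := hχ1.exists_lipschitzOnWith
  have hφc : ContinuousAt φ x₀ :=
    (hφ.contDiffOn.continuousOn.continuousAt (hφ.isOpen.mem_nhds (hΩU hx₀)))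
  have hx₀n : s₁ ∩ (W ∩ (Ω ∩ φ ⁻¹' s₄)) ∈ 𝓝 x₀ :=
    inter_mem hs₁ (inter_mem (hWo.mem_nhds hx₀W) (inter_mem (hΩ.mem_nhds hx₀) (hφc hs₄)))
  have hsymm : P.symm (f x₀) = x₀ := P.left_inv hx₀P
  have hpre : P.symm ⁻¹' (s₁ ∩ (W ∩ (Ω ∩ φ ⁻¹' s₄))) ∈ 𝓝 (f x₀) := by
    refine (P.continuousAt_symm hz₀) ?_
    rw [hsymm]
    exact hx₀n
  have hfst : Prod.fst ⁻¹' s₃ ∈ 𝓝 (f x₀) := continuous_fst.continuousAt hs₃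
  obtain ⟨ρ, hρ, hball⟩ := Metric.mem_nhds_iff.1
    (inter_mem (inter_mem hpre hfst) (inter_mem hs₂ (P.open_target.mem_nhds hz₀)))
  set B := Metric.ball (f x₀) ρ with hB
  -- The chart is cut down on the target side, so that its target is exactly `B`, a product of balls
  -- for the sup norm.
  set Q := (P.symm.restrOpen B Metric.isOpen_ball).symm with hQ
  have hQt : Q.target = B := by
    change P.target ∩ B = B
    exact inter_eq_right.2 fun z hz => (hball hz).2.2
  have hQP : Q.source ⊆ P.source := inter_subset_left
  have hsrc : ∀ x ∈ Q.source, x ∈ s₁ ∧ x ∈ W ∧ x ∈ Ω ∧ φ x ∈ s₄ := fun x hx => by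
    have h1 := (hball hx.2).1.1
    rw [mem_preimage, show P.symm (P.symm.symm x) = x from P.left_inv hx.1] at h1
    exact ⟨h1.1, h1.2.1, h1.2.2.1, h1.2.2.2⟩
  refine ⟨⟨Q, κ x₀, A x₀, ρ, ψ, χ, hQt, fun x hx => (hsrc x hx).2.2.1, hP1.mono hQP, ?_,
    fun x hx => hψκ x (hsrc x hx).2.1, fun x hx => hχφ x (hsrc x hx).2.1,
    ⟨K₁, hl₁.mono fun x hx => (hsrc x hx).1⟩, ⟨K₂, ?_⟩, ⟨K₃, hl₃.mono fun y hy => ?_⟩,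
    ⟨K₄, hl₄.mono ?_⟩, fun x hx v => ?_⟩, ⟨hx₀P, Metric.mem_ball_self hρ⟩⟩
  · rw [hQt]
    exact hP2.mono fun z hz => (hball hz).2.2
  · rw [hQt]
    exact hl₂.mono fun z hz => (hball hz).2.1
  · have : (y, A x₀) ∈ B := by
      rw [hB, hf, ← ball_prod_same]
      exact ⟨hy, Metric.mem_ball_self hρ⟩
    exact (hball this).1.2
  · rintro _ ⟨x, hx, rfl⟩
    exact (hsrc x hx).2.2.2
  · have hxW := (hsrc x hx).2.1
    rw [← hker x hxW, show fderiv ℝ Q x = _ from (hfd x hxW).fderiv]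
    rfl

/-! ### Integration by parts and change of variables in a fiber chart -/

theorem continuous_of_continuousOn_of_eq_zero {A B : Type*} [TopologicalSpace A] [T2Space A]
    [TopologicalSpace B] [Zero B] {s K : Set A} (hs : IsOpen s) (hK : IsCompact K) (hKs : K ⊆ s)
    {p : A → B} (hp : ContinuousOn p s) (h0 : ∀ x ∉ K, p x = 0) :
    Continuous p ∧ HasCompactSupport p ∧ tsupport p ⊆ K := by
  refine ⟨continuous_iff_continuousAt.2 fun x => ?_, HasCompactSupport.intro hK h0,
    closure_minimal (fun x hx => by_contra fun h => hx (h0 x h)) hK.isClosed⟩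
  by_cases hx : x ∈ K
  · exact hp.continuousAt (hs.mem_nhds (hKs hx))
  · refine (continuousAt_const (y := (0 : B))).congr ?_
    filter_upwards [hK.isClosed.isOpen_compl.mem_nhds hx] with y hy
    exact (h0 y hy).symm

/-- Integration by parts for a test function supported in an open set against a function which is
`C¹` on that set. -/
theorem integral_mul_fderiv_eq_neg_of_contDiffOn {H : Type*} [NormedAddCommGroup H]
    [NormedSpace ℝ H] [FiniteDimensional ℝ H] [MeasurableSpace H] [BorelSpace H] {μ : Measure H}
    [μ.IsAddHaarMeasure] {T : Set H} (hT : IsOpen T) {ζ q : H → ℝ} (hζ : ContDiff ℝ ∞ ζ)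
    (hζc : HasCompactSupport ζ) (hζT : tsupport ζ ⊆ T) (hq : ContDiffOn ℝ 1 q T) (v : H) :
    ∫ z, ζ z * fderiv ℝ q z v ∂μ = - ∫ z, fderiv ℝ ζ z v * q z ∂μ := by
  have hζ0 : ∀ z ∉ tsupport ζ, ζ z = 0 := fun z hz => image_eq_zero_of_notMem_tsupport hz
  have hdζ0 : ∀ z ∉ tsupport ζ, fderiv ℝ ζ z = 0 := fun z hz => fderiv_of_notMem_tsupport ℝ hz
  have hdζ : Continuous fun z => fderiv ℝ ζ z v :=
    (hζ.continuous_fderiv (by simp)).clm_apply continuous_const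
  have hdq : ContinuousOn (fun z => fderiv ℝ q z v) T :=
    (hq.continuousOn_fderiv_of_isOpen hT le_rfl).clm_apply continuousOn_const
  have hint : ∀ p : H → ℝ, ContinuousOn p T → (∀ z ∉ tsupport ζ, p z = 0) → Integrable p μ :=
    fun p hp h0 => by
      obtain ⟨h1, h2, -⟩ := continuous_of_continuousOn_of_eq_zero hT hζc hζT hp h0
      exact h1.integrable_of_hasCompactSupport h2
  refine integral_mul_fderiv_eq_neg_fderiv_mul_of_integrable ?_ ?_ ?_
    (fun z _ => (hζ.differentiable (by simp)).differentiableAt)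
    (fun z hz => (hq.contDiffAt (hT.mem_nhds (hζT hz))).differentiableAt one_ne_zero)
  · exact hint _ (hdζ.continuousOn.mul hq.continuousOn) fun z hz => by simp [hdζ0 z hz]
  · exact hint _ (hζ.continuous.continuousOn.mul hdq) fun z hz => by simp [hζ0 z hz]
  · exact hint _ (hζ.continuous.continuousOn.mul hq.continuousOn) fun z hz => by simp [hζ0 z hz]

/-- All Haar measures have the null sets of the Hausdorff measure of the full dimension, and
Lipschitz maps preserve those. This bypasses the mismatch between Euclidean and sup norms. -/
theorem measure_image_eq_zero_of_lipschitzOnWith {H H' : Type*} [NormedAddCommGroup H]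
    [NormedSpace ℝ H] [FiniteDimensional ℝ H] [MeasurableSpace H] [BorelSpace H]
    [NormedAddCommGroup H'] [NormedSpace ℝ H'] [FiniteDimensional ℝ H'] [MeasurableSpace H']
    [BorelSpace H'] {μ : Measure H} [μ.IsAddHaarMeasure] {ν : Measure H'} [ν.IsAddHaarMeasure]
    (hd : Module.finrank ℝ H = Module.finrank ℝ H') {f : H → H'} {s : Set H} {K : NNReal}
    (hf : LipschitzOnWith K f s) (hs : μ s = 0) : ν (f '' s) = 0 := by
  have h1 : μH[Module.finrank ℝ H] s = 0 := absolutelyContinuous_isAddHaarMeasure _ μ hs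
  refine absolutelyContinuous_isAddHaarMeasure ν μH[Module.finrank ℝ H'] ?_
  rw [← hd]
  have h2 := hf.hausdorffMeasure_image_le (d := (Module.finrank ℝ H : ℝ)) (by positivity)
  rw [h1, mul_zero] at h2
  exact le_antisymm h2 zero_le

namespace FiberChart

variable {ℓ k m : ℕ} {M Ω : Set (EuclideanSpace ℝ (Fin ℓ))}
  {φ : EuclideanSpace ℝ (Fin ℓ) → EuclideanSpace ℝ (Fin ℓ)} (c : FiberChart k m M Ω φ)

local notation "𝔼" => EuclideanSpace ℝ (Fin ℓ)
local notation "𝔽" => EuclideanSpace ℝ (Fin k)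
local notation "𝔾" => EuclideanSpace ℝ (Fin m)

theorem mem_target {y : 𝔽} {n : 𝔾} :
    (y, n) ∈ c.Φ.target ↔ y ∈ Metric.ball c.y₀ c.ρ ∧ n ∈ Metric.ball c.n₀ c.ρ := by
  rw [c.target_eq, ← ball_prod_same, mem_prod]

theorem hasFDerivAt {x : 𝔼} (hx : x ∈ c.Φ.source) : HasFDerivAt c.Φ (fderiv ℝ c.Φ x) x :=
  ((c.contDiffOn.contDiffAt (c.Φ.open_source.mem_nhds hx)).differentiableAt
    one_ne_zero).hasFDerivAt

theorem hasFDerivAt_symm {z : 𝔽 × 𝔾} (hz : z ∈ c.Φ.target) :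
    HasFDerivAt c.Φ.symm (fderiv ℝ c.Φ.symm z) z :=
  ((c.contDiffOn_symm.contDiffAt (c.Φ.open_target.mem_nhds hz)).differentiableAt
    one_ne_zero).hasFDerivAt

theorem fderiv_symm_fderiv {x : 𝔼} (hx : x ∈ c.Φ.source) (v : 𝔼) :
    fderiv ℝ c.Φ.symm (c.Φ x) (fderiv ℝ c.Φ x v) = v := by
  have h1 := (c.hasFDerivAt_symm (c.Φ.map_source hx)).comp x (c.hasFDerivAt hx)
  have h2 := h1.unique ((hasFDerivAt_id x).congr_of_eventuallyEq
    (Eventually.mono (c.Φ.open_source.mem_nhds hx)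
      fun x' hx' => c.Φ.left_inv hx'))
  exact congrArg (fun T : 𝔼 →L[ℝ] 𝔼 => T v) h2

theorem fderiv_fderiv_symm {x : 𝔼} (hx : x ∈ c.Φ.source) (v : 𝔽 × 𝔾) :
    fderiv ℝ c.Φ x (fderiv ℝ c.Φ.symm (c.Φ x) v) = v := by
  have hz := c.Φ.map_source hx
  have h0 : HasFDerivAt c.Φ (fderiv ℝ c.Φ x) (c.Φ.symm (c.Φ x)) := by
    rw [c.Φ.left_inv hx]
    exact c.hasFDerivAt hx
  have h1 := h0.comp (c.Φ x) (c.hasFDerivAt_symm hz)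
  have h2 := h1.unique ((hasFDerivAt_id (c.Φ x)).congr_of_eventuallyEq
    (Eventually.mono (c.Φ.open_target.mem_nhds hz)
      fun z hz => c.Φ.right_inv hz))
  exact congrArg (fun T : (𝔽 × 𝔾) →L[ℝ] (𝔽 × 𝔾) => T v) h2

theorem fderiv_symm_mem_orthogonal {x : 𝔼} (hx : x ∈ c.Φ.source) (w : 𝔾) :
    fderiv ℝ c.Φ.symm (c.Φ x) (0, w) ∈ (tangentSpaceAt M (φ x))ᗮ := by
  rw [← c.ker_eq x hx, c.fderiv_fderiv_symm hx]

theorem exists_fderiv_symm_eq {x : 𝔼} (hx : x ∈ c.Φ.source) {v : 𝔼}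
    (hv : v ∈ (tangentSpaceAt M (φ x))ᗮ) :
    ∃ w : 𝔾, fderiv ℝ c.Φ.symm (c.Φ x) (0, w) = v := by
  refine ⟨(fderiv ℝ c.Φ x v).2, ?_⟩
  have h1 : ((0 : 𝔽), (fderiv ℝ c.Φ x v).2) = fderiv ℝ c.Φ x v :=
    Prod.ext ((c.ker_eq x hx v).2 hv).symm rfl
  rw [h1, c.fderiv_symm_fderiv hx]

theorem volume_symm_image_eq_zero (hkm : k + m = ℓ) {N : Set (𝔽 × 𝔾)} (hN : N ⊆ c.Φ.target)
    (h0 : volume N = 0) : volume (c.Φ.symm '' N) = 0 := by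
  obtain ⟨K, hK⟩ := c.lipschitz_symm
  exact measure_image_eq_zero_of_lipschitzOnWith (by simp [hkm]) (hK.mono hN) h0

/-- Change of variables in a fiber chart. -/
theorem exists_jacobian (hkm : k + m = ℓ) : ∃ J : 𝔼 → ℝ, ContinuousOn J c.Φ.source ∧
    (∃ C, ∀ x ∈ c.Φ.source, ‖J x‖ ≤ C) ∧
    (∀ g : 𝔽 × 𝔾 → ℝ, ∫ z in c.Φ.target, g z = ∫ x in c.Φ.source, J x * g (c.Φ x)) ∧
    ∀ g : 𝔽 × 𝔾 → ℝ, IntegrableOn (fun x => J x * g (c.Φ x)) c.Φ.source →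
      IntegrableOn g c.Φ.target := by
  -- The change of variables formula concerns maps of one space into itself, so the product is
  -- identified linearly with `𝔼`; by uniqueness of Haar measure this costs only a constant factor
  -- `a`.
  let e : (𝔽 × 𝔾) ≃L[ℝ] 𝔼 := ContinuousLinearEquiv.ofFinrankEq (by simp [hkm])
  have hemb : MeasurableEmbedding e.symm := e.symm.toHomeomorph.measurableEmbedding
  have : (map e.symm (volume : Measure 𝔼)).IsAddHaarMeasure :=
    e.symm.isAddHaarMeasure_map (volume : Measure 𝔼)
  obtain ⟨a, ha0, ha, hvol⟩ : ∃ a : ENNReal, a ≠ 0 ∧ a ≠ ⊤ ∧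
      (volume : Measure (𝔽 × 𝔾)) = a • map e.symm (volume : Measure 𝔼) :=
    ⟨(addHaarScalarFactor (volume : Measure (𝔽 × 𝔾)) (map e.symm (volume : Measure 𝔼)) : NNReal),
      by simpa using (addHaarScalarFactor_pos_of_isAddHaarMeasure _ _).ne', by simp,
      isAddLeftInvariant_eq_smul _ _⟩
  have hpre : e.symm ⁻¹' c.Φ.target = (fun x => e (c.Φ x)) '' c.Φ.source := by
    rw [show (fun x => e (c.Φ x)) = e ∘ c.Φ from rfl, image_comp, c.Φ.image_source_eq_target]
    exact (e.toEquiv.image_eq_preimage_symm _).symm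
  have hd : ∀ x ∈ c.Φ.source, HasFDerivWithinAt (fun x => e (c.Φ x))
      ((e : (𝔽 × 𝔾) →L[ℝ] 𝔼).comp (fderiv ℝ c.Φ x)) c.Φ.source x := fun x hx =>
    ((e : (𝔽 × 𝔾) →L[ℝ] 𝔼).hasFDerivAt.comp x (c.hasFDerivAt hx)).hasFDerivWithinAt
  have hinj : InjOn (fun x => e (c.Φ x)) c.Φ.source := e.injective.comp_injOn c.Φ.injOn
  have hms : MeasurableSet c.Φ.source := c.Φ.open_source.measurableSet
  have hcomp : Continuous fun T : 𝔼 →L[ℝ] (𝔽 × 𝔾) => ((e : (𝔽 × 𝔾) →L[ℝ] 𝔼).comp T).det :=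
    ContinuousLinearMap.continuous_det.comp (by fun_prop)
  refine ⟨fun x => a.toReal * |((e : (𝔽 × 𝔾) →L[ℝ] 𝔼).comp (fderiv ℝ c.Φ x)).det|,
    ?_, ?_, fun g => ?_, fun g hg => ?_⟩
  · exact continuousOn_const.mul (hcomp.comp_continuousOn
      (c.contDiffOn.continuousOn_fderiv_of_isOpen c.Φ.open_source le_rfl)).abs
  · obtain ⟨K, hK⟩ := c.lipschitz
    obtain ⟨C, hC⟩ := (isCompact_closedBall (0 : 𝔼 →L[ℝ] (𝔽 × 𝔾)) K).exists_bound_of_continuousOn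
      hcomp.continuousOn
    refine ⟨a.toReal * C, fun x hx => ?_⟩
    rw [norm_mul, Real.norm_of_nonneg ENNReal.toReal_nonneg, norm_abs_eq_norm]
    gcongr
    refine hC _ ?_
    rw [mem_closedBall_zero_iff]
    exact norm_fderiv_le_of_lipschitzOn ℝ (c.Φ.open_source.mem_nhds hx) hK
  · rw [hvol, Measure.restrict_smul, integral_smul_measure, hemb.setIntegral_map, hpre,
      integral_image_eq_integral_abs_det_fderiv_smul volume hms hd hinj, smul_eq_mul,
      ← integral_const_mul]
    simp [mul_assoc]
  · rw [IntegrableOn, hvol, Measure.restrict_smul]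
    refine Integrable.smul_measure ?_ ha
    change IntegrableOn g _ _
    rw [hemb.integrableOn_map_iff, hpre,
      integrableOn_image_iff_integrableOn_abs_det_fderiv_smul volume hms hd hinj]
    have h1 := Integrable.const_mul hg (a.toReal)⁻¹
    have h2 : a.toReal ≠ 0 := ENNReal.toReal_ne_zero.2 ⟨ha0, ha⟩
    refine h1.congr (Eventually.of_forall fun x => ?_)
    simp [mul_assoc, h2]

theorem integrableOn_comp_symm (hkm : k + m = ℓ) {u : 𝔼 → ℝ} (hu : IntegrableOn u c.Φ.source) :
    IntegrableOn (fun z => u (c.Φ.symm z)) c.Φ.target := by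
  obtain ⟨J, hJ, ⟨C, hC⟩, -, hint⟩ := c.exists_jacobian hkm
  have hms : MeasurableSet c.Φ.source := c.Φ.open_source.measurableSet
  refine hint _ ?_
  have h1 : IntegrableOn (fun x => J x * u x) c.Φ.source :=
    Integrable.bdd_mul (c := C) hu (hJ.aestronglyMeasurable hms)
      (ae_restrict_of_forall_mem hms hC)
  refine h1.congr_fun (fun x hx => ?_) hms
  simp only [c.Φ.left_inv hx]

/-- The weak derivative of `u` in the directions of the fibers, read in a fiber chart. -/
theorem integral_mul_fderiv_eq (hkm : k + m = ℓ) (hΩ : IsOpen Ω) {u : 𝔼 → ℝ} {g : 𝔼 → 𝔼}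
    (hg : IsL2WeakGradient Ω u g) (hu : IntegrableOn u Ω) (hgi : IntegrableOn g Ω)
    {ζ : 𝔽 × 𝔾 → ℝ} (hζ : ContDiff ℝ ∞ ζ) (hζc : HasCompactSupport ζ)
    (hζT : tsupport ζ ⊆ c.Φ.target) (w : 𝔾) :
    ∫ z in c.Φ.target, u (c.Φ.symm z) * fderiv ℝ ζ z (0, w) =
      - ∫ z in c.Φ.target,
        ζ z * inner ℝ (g (c.Φ.symm z)) (fderiv ℝ c.Φ.symm z (0, w)) := by
  obtain ⟨J, hJ, -, hJi, -⟩ := c.exists_jacobian hkm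
  have hso := c.Φ.open_source
  have hto := c.Φ.open_target
  have hms : MeasurableSet c.Φ.source := hso.measurableSet
  have hΦc : ContinuousOn c.Φ c.Φ.source := c.Φ.continuousOn
  -- This is the field `ζ • (0, w)` pulled back with the Jacobian weight. With this weight its
  -- divergence is `h`, in which no derivative of the merely continuous `J` occurs.
  set X : 𝔼 → 𝔼 := c.Φ.source.indicator fun x =>
    (J x * ζ (c.Φ x)) • fderiv ℝ c.Φ.symm (c.Φ x) (0, w) with hXdef
  set h : 𝔼 → ℝ := c.Φ.source.indicator fun x => J x * fderiv ℝ ζ (c.Φ x) (0, w) with hhdef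
  have hXs : ∀ x ∈ c.Φ.source,
      X x = (J x * ζ (c.Φ x)) • fderiv ℝ c.Φ.symm (c.Φ x) (0, w) := fun x hx =>
    indicator_of_mem hx _
  have hhs : ∀ x ∈ c.Φ.source, h x = J x * fderiv ℝ ζ (c.Φ x) (0, w) := fun x hx =>
    indicator_of_mem hx _
  have hXn : ∀ x ∉ c.Φ.source, X x = 0 := fun x hx => indicator_of_notMem hx _
  have hhn : ∀ x ∉ c.Φ.source, h x = 0 := fun x hx => indicator_of_notMem hx _
  set K := c.Φ.symm '' tsupport ζ with hKdef
  have hK : IsCompact K := hζc.isCompact.image_of_continuousOn (c.Φ.continuousOn_symm.mono hζT)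
  have hKs : K ⊆ c.Φ.source := by
    rintro _ ⟨z, hz, rfl⟩
    exact c.Φ.map_target (hζT hz)
  have hKn : ∀ x ∈ c.Φ.source, x ∉ K → c.Φ x ∉ tsupport ζ := fun x hx hxK hz =>
    hxK ⟨_, hz, c.Φ.left_inv hx⟩
  have hX0 : ∀ x ∉ K, X x = 0 := fun x hx => by
    by_cases hxs : x ∈ c.Φ.source
    · rw [hXs x hxs, image_eq_zero_of_notMem_tsupport (hKn x hxs hx)]
      simp
    · exact hXn x hxs
  have hh0 : ∀ x ∉ K, h x = 0 := fun x hx => by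
    by_cases hxs : x ∈ c.Φ.source
    · rw [hhs x hxs, fderiv_of_notMem_tsupport ℝ (hKn x hxs hx)]
      simp
    · exact hhn x hxs
  have hXc : ContinuousOn X c.Φ.source := by
    refine ContinuousOn.congr ?_ hXs
    refine (hJ.mul (hζ.continuous.comp_continuousOn hΦc)).smul ?_
    exact ((c.contDiffOn_symm.continuousOn_fderiv_of_isOpen hto le_rfl).comp hΦc
      c.Φ.mapsTo).clm_apply continuousOn_const
  have hhc : ContinuousOn h c.Φ.source := by
    refine ContinuousOn.congr ?_ hhs
    exact hJ.mul (((hζ.continuous_fderiv (by simp)).comp_continuousOn hΦc).clm_apply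
      continuousOn_const)
  obtain ⟨hX1, hX2, hX3⟩ := continuous_of_continuousOn_of_eq_zero hso hK hKs hXc hX0
  obtain ⟨hh1, hh2, -⟩ := continuous_of_continuousOn_of_eq_zero hso hK hKs hhc hh0
  -- Carried to the box, this is integration by parts between `ζ` and the `C¹` function `γ ∘ Φ⁻¹`.
  have hdiv : ∀ γ : 𝔼 → ℝ, ContDiff ℝ ∞ γ → HasCompactSupport γ →
      ∫ x, fderiv ℝ γ x (X x) = - ∫ x, h x * γ x := by
    intro γ hγ _
    have hq : ContDiffOn ℝ 1 (fun z => γ (c.Φ.symm z)) c.Φ.target :=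
      (hγ.of_le (by exact_mod_cast le_top)).comp_contDiffOn c.contDiffOn_symm
    have hibp := integral_mul_fderiv_eq_neg_of_contDiffOn (μ := volume) hto hζ hζc hζT hq (0, w)
    have h1 : ∫ x, fderiv ℝ γ x (X x) =
        ∫ z, ζ z * fderiv ℝ (fun z => γ (c.Φ.symm z)) z (0, w) := by
      rw [← setIntegral_eq_integral_of_forall_compl_eq_zero (s := c.Φ.source)
          fun x hx => by simp [hXn x hx],
        ← setIntegral_eq_integral_of_forall_compl_eq_zero (s := c.Φ.target)
          fun z hz => by simp [image_eq_zero_of_notMem_tsupport (fun h => hz (hζT h))], hJi]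
      refine setIntegral_congr_fun hms fun x hx => ?_
      have h2 : HasFDerivAt (fun z => γ (c.Φ.symm z))
          ((fderiv ℝ γ (c.Φ.symm (c.Φ x))).comp (fderiv ℝ c.Φ.symm (c.Φ x))) (c.Φ x) :=
        ((hγ.differentiable (by simp)).differentiableAt.hasFDerivAt).comp (c.Φ x)
          (c.hasFDerivAt_symm (c.Φ.map_source hx))
      rw [h2.fderiv, c.Φ.left_inv hx, hXs x hx]
      simp [mul_assoc]
    have h2 : ∫ x, h x * γ x = ∫ z, fderiv ℝ ζ z (0, w) * γ (c.Φ.symm z) := by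
      rw [← setIntegral_eq_integral_of_forall_compl_eq_zero (s := c.Φ.source)
          fun x hx => by simp [hhn x hx],
        ← setIntegral_eq_integral_of_forall_compl_eq_zero (s := c.Φ.target)
          fun z hz => by simp [fderiv_of_notMem_tsupport ℝ (fun h => hz (hζT h))], hJi]
      refine setIntegral_congr_fun hms fun x hx => ?_
      rw [c.Φ.left_inv hx, hhs x hx, mul_assoc]
    rw [h1, h2, hibp]
  have hmain := hg.integral_mul_div hΩ hu hgi hX1 hX2 (hX3.trans (hKs.trans c.source_subset))
    hh1 hh2 hdiv
  rw [setIntegral_eq_of_subset_of_forall_sdiff_eq_zero hΩ.measurableSet c.source_subset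
      fun x hx => by simp [hhn x hx.2],
    setIntegral_eq_of_subset_of_forall_sdiff_eq_zero hΩ.measurableSet c.source_subset
      fun x hx => by simp [hXn x hx.2]] at hmain
  rw [hJi, hJi]
  convert hmain using 1
  · refine setIntegral_congr_fun hms fun x hx => ?_
    rw [c.Φ.left_inv hx, hhs x hx]
    ring
  · congr 1
    refine setIntegral_congr_fun hms fun x hx => ?_
    rw [c.Φ.left_inv hx, hXs x hx, inner_smul_right, mul_assoc]

end FiberChart

/-! ### Null sets, plaques and tangential gradients -/

theorem hausdorffMeasure_eq_zero_iff_volume {n : ℕ} {s : Set (EuclideanSpace ℝ (Fin n))} :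
    μH[(n : ℝ)] s = 0 ↔ volume s = 0 := by
  have h : (μH[(n : ℝ)] : Measure (EuclideanSpace ℝ (Fin n))).IsAddHaarMeasure := by
    simpa using isAddHaarMeasure_hausdorffMeasure (E := EuclideanSpace ℝ (Fin n))
  exact ⟨fun h0 => absolutelyContinuous_isAddHaarMeasure _ _ h0,
    fun h0 => absolutelyContinuous_isAddHaarMeasure _ _ h0⟩

theorem hausdorffMeasure_image_eq_zero {A B : Type*} [EMetricSpace A] [EMetricSpace B]
    [MeasurableSpace A] [BorelSpace A] [MeasurableSpace B] [BorelSpace B] {f : A → B} {s t : Set A}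
    {K : NNReal} (hf : LipschitzOnWith K f s) (hts : t ⊆ s) {d : ℝ} (hd : 0 ≤ d)
    (ht : μH[d] t = 0) : μH[d] (f '' t) = 0 := by
  have h := (hf.mono hts).hausdorffMeasure_image_le hd
  rw [ht, mul_zero] at h
  exact le_antisymm h zero_le

theorem normalProj_eq_zero_iff {ℓ : ℕ} {M : Set (EuclideanSpace ℝ (Fin ℓ))}
    {φ : EuclideanSpace ℝ (Fin ℓ) → EuclideanSpace ℝ (Fin ℓ)} {x v : EuclideanSpace ℝ (Fin ℓ)} :
    normalProj M φ x v = 0 ↔ v ∈ tangentSpaceAt M (φ x) := by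
  rw [← Submodule.starProjection_eq_self_iff]
  simp only [normalProj, tangentialProj, _root_.sub_apply,
    ContinuousLinearMap.id_apply, sub_eq_zero]
  exact eq_comm

namespace FiberChart

variable {ℓ k m : ℕ} {M Ω : Set (EuclideanSpace ℝ (Fin ℓ))}
  {φ : EuclideanSpace ℝ (Fin ℓ) → EuclideanSpace ℝ (Fin ℓ)} (c : FiberChart k m M Ω φ)

local notation "𝔼" => EuclideanSpace ℝ (Fin ℓ)
local notation "𝔽" => EuclideanSpace ℝ (Fin k)
local notation "𝔾" => EuclideanSpace ℝ (Fin m)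

theorem center_mem {y : 𝔽} (hy : y ∈ Metric.ball c.y₀ c.ρ) : c.n₀ ∈ Metric.ball c.n₀ c.ρ :=
  Metric.mem_ball_self (Metric.pos_of_mem_ball hy)

theorem symm_mem_source {y : 𝔽} {n : 𝔾} (hy : y ∈ Metric.ball c.y₀ c.ρ)
    (hn : n ∈ Metric.ball c.n₀ c.ρ) : c.Φ.symm (y, n) ∈ c.Φ.source :=
  c.Φ.map_target (c.mem_target.2 ⟨hy, hn⟩)

theorem apply_symm {y : 𝔽} {n : 𝔾} (hy : y ∈ Metric.ball c.y₀ c.ρ)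
    (hn : n ∈ Metric.ball c.n₀ c.ρ) : c.Φ (c.Φ.symm (y, n)) = (y, n) :=
  c.Φ.right_inv (c.mem_target.2 ⟨hy, hn⟩)

theorem apply_mem {x : 𝔼} (hx : x ∈ c.Φ.source) :
    (c.Φ x).1 ∈ Metric.ball c.y₀ c.ρ ∧ (c.Φ x).2 ∈ Metric.ball c.n₀ c.ρ :=
  c.mem_target.1 (c.Φ.map_source hx)

theorem map_symm {y : 𝔽} {n : 𝔾} (hy : y ∈ Metric.ball c.y₀ c.ρ)
    (hn : n ∈ Metric.ball c.n₀ c.ρ) : φ (c.Φ.symm (y, n)) = c.ψ y := by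
  rw [← c.param _ (c.symm_mem_source hy hn), c.apply_symm hy hn]

/-- The second chart coordinate is Lipschitz, and the bad `n` lie in its image of `S`. -/
theorem ae_symm_notMem {S : Set 𝔼} (hS : μH[(m : ℝ)] S = 0) {y : 𝔽}
    (hy : y ∈ Metric.ball c.y₀ c.ρ) :
    ∀ᵐ n : 𝔾, n ∈ Metric.ball c.n₀ c.ρ → c.Φ.symm (y, n) ∉ S := by
  obtain ⟨K, hK⟩ := c.lipschitz
  have h1 : μH[(m : ℝ)] ((fun x => (c.Φ x).2) '' (S ∩ c.Φ.source)) = 0 :=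
    hausdorffMeasure_image_eq_zero (LipschitzWith.prod_snd.comp_lipschitzOnWith hK)
      inter_subset_right (by positivity) (measure_mono_null inter_subset_left hS)
  refine measure_mono_null (fun n hn => ?_) (hausdorffMeasure_eq_zero_iff_volume.1 h1)
  simp only [mem_compl_iff, mem_ofPred_eq, not_forall, not_not] at hn
  obtain ⟨hn, hnS⟩ := hn
  exact ⟨_, ⟨hnS, c.symm_mem_source hy hn⟩, by simp only [c.apply_symm hy hn]⟩

theorem hausdorffMeasure_plaque_image_eq_zero {y : 𝔽} (hy : y ∈ Metric.ball c.y₀ c.ρ) {N : Set 𝔾}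
    (hN : N ⊆ Metric.ball c.n₀ c.ρ) (h0 : volume N = 0) :
    μH[(m : ℝ)] ((fun n => c.Φ.symm (y, n)) '' N) = 0 := by
  obtain ⟨K, hK⟩ := c.lipschitz_symm
  refine hausdorffMeasure_image_eq_zero (K := K * 1) (s := Metric.ball c.n₀ c.ρ)
    (hK.comp ((LipschitzWith.prodMk_left y).lipschitzOnWith) fun n hn => c.mem_target.2 ⟨hy, hn⟩)
    hN (by positivity) (hausdorffMeasure_eq_zero_iff_volume.2 h0)

/-- The Lipschitz coordinate `χ` recovers `y` from `ψ y`, so the bad `y` lie in a Lipschitz image of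
a part of `Z`. -/
theorem ae_param_notMem {Z : Set 𝔼} (hZ : μH[(k : ℝ)] Z = 0) :
    ∀ᵐ y : 𝔽, y ∈ Metric.ball c.y₀ c.ρ → c.ψ y ∉ Z := by
  obtain ⟨K, hK⟩ := c.lipschitz_coord
  have h1 : μH[(k : ℝ)] (c.χ '' (Z ∩ φ '' c.Φ.source)) = 0 :=
    hausdorffMeasure_image_eq_zero hK inter_subset_right (by positivity)
      (measure_mono_null inter_subset_left hZ)
  refine measure_mono_null (fun y hy => ?_) (hausdorffMeasure_eq_zero_iff_volume.1 h1)
  simp only [mem_compl_iff, mem_ofPred_eq, not_forall, not_not] at hy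
  obtain ⟨hy, hyZ⟩ := hy
  have hn := c.center_mem hy
  have hs := c.symm_mem_source hy hn
  rw [← c.map_symm hy hn] at hyZ
  refine ⟨_, ⟨hyZ, mem_image_of_mem φ hs⟩, ?_⟩
  rw [c.coord _ hs, c.apply_symm hy hn]

theorem hausdorffMeasure_param_image_eq_zero {Y : Set 𝔽} (hY : Y ⊆ Metric.ball c.y₀ c.ρ)
    (h0 : volume Y = 0) : μH[(k : ℝ)] (c.ψ '' Y) = 0 := by
  obtain ⟨K, hK⟩ := c.lipschitz_param
  exact hausdorffMeasure_image_eq_zero hK hY (by positivity)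
    (hausdorffMeasure_eq_zero_iff_volume.2 h0)

/-- If the gradient of `u` is tangential, then `u` is almost everywhere constant along almost every
plaque. -/
theorem ae_plaque_const_of_gradient_mem (hkm : k + m = ℓ) (hΩ : IsOpen Ω) {u : 𝔼 → ℝ} {g : 𝔼 → 𝔼}
    (hg : IsL2WeakGradient Ω u g) (hu : IntegrableOn u Ω) (hgi : IntegrableOn g Ω)
    (hT : ∀ᵐ x, x ∈ c.Φ.source → g x ∈ tangentSpaceAt M (φ x)) :
    ∀ᵐ y : 𝔽, y ∈ Metric.ball c.y₀ c.ρ →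
      ∃ a, ∀ᵐ n : 𝔾, n ∈ Metric.ball c.n₀ c.ρ → u (c.Φ.symm (y, n)) = a := by
  have hint := c.integrableOn_comp_symm hkm (hu.mono_set c.source_subset)
  rw [c.target_eq] at hint
  refine ae_exists_ae_eq_const (f := fun z => u (c.Φ.symm z)) hint fun ζ hζ hζc hζB w => ?_
  rw [← c.target_eq] at hζB ⊢
  rw [c.integral_mul_fderiv_eq hkm hΩ hg hu hgi hζ hζc hζB w, neg_eq_zero]
  obtain ⟨J, -, -, hJi, -⟩ := c.exists_jacobian hkm
  rw [hJi]
  refine setIntegral_eq_zero_of_ae_eq_zero ?_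
  filter_upwards [hT] with x hx hxs
  rw [c.Φ.left_inv hxs,
    (Submodule.mem_orthogonal _ _).1 (c.fderiv_symm_mem_orthogonal hxs w) _ (hx hxs)]
  simp

theorem integrableOn_inner_fderiv_symm (hkm : k + m = ℓ) {g : 𝔼 → 𝔼}
    (hg : IntegrableOn g c.Φ.source) (w : 𝔾) :
    IntegrableOn (fun z => inner ℝ (g (c.Φ.symm z)) (fderiv ℝ c.Φ.symm z (0, w))) c.Φ.target := by
  obtain ⟨K, hK⟩ := c.lipschitz_symm
  have hcont : ContinuousOn (fun z => fderiv ℝ c.Φ.symm z (0, w)) c.Φ.target :=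
    (c.contDiffOn_symm.continuousOn_fderiv_of_isOpen c.Φ.open_target le_rfl).clm_apply
      continuousOn_const
  have hmt := c.Φ.open_target.measurableSet
  simp only [PiLp.inner_apply]
  refine integrable_finsetSum _ fun i _ => ?_
  have hgi : IntegrableOn (fun x => g x i) c.Φ.source :=
    (EuclideanSpace.proj (𝕜 := ℝ) i : 𝔼 →L[ℝ] ℝ).integrable_comp hg
  have hb : ∀ z ∈ c.Φ.target, ‖fderiv ℝ c.Φ.symm z (0, w) i‖ ≤ K * ‖((0 : 𝔽), w)‖ := fun z hz =>
    (PiLp.norm_apply_le _ i).trans (((fderiv ℝ c.Φ.symm z).le_opNorm _).trans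
      (by gcongr; exact norm_fderiv_le_of_lipschitzOn ℝ (c.Φ.open_target.mem_nhds hz) hK))
  have hm : ContinuousOn (fun z => fderiv ℝ c.Φ.symm z (0, w) i) c.Φ.target :=
    (EuclideanSpace.proj (𝕜 := ℝ) i : 𝔼 →L[ℝ] ℝ).continuous.comp_continuousOn hcont
  have := Integrable.mul_bdd (c := K * ‖((0 : 𝔽), w)‖) (c.integrableOn_comp_symm hkm hgi)
    (hm.aestronglyMeasurable hmt) (ae_restrict_of_forall_mem hmt hb)
  simpa [mul_comm] using this

/-- By Fubini it suffices to integrate over each plaque, where the a.e. constant value factors out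
and the derivative of a compactly supported function integrates to zero. -/
theorem integral_mul_fderiv_eq_zero {f : 𝔽 × 𝔾 → ℝ} {ζ : 𝔽 × 𝔾 → ℝ}
    (hf : IntegrableOn f c.Φ.target) (hζ : ContDiff ℝ ∞ ζ) (hζc : HasCompactSupport ζ)
    (hζT : tsupport ζ ⊆ c.Φ.target)
    (hc : ∀ᵐ y : 𝔽, y ∈ Metric.ball c.y₀ c.ρ →
      ∃ a, ∀ᵐ n : 𝔾, n ∈ Metric.ball c.n₀ c.ρ → f (y, n) = a) (w : 𝔾) :
    ∫ z in c.Φ.target, f z * fderiv ℝ ζ z (0, w) = 0 := by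
  have hdζ : Continuous fun z => fderiv ℝ ζ z (0, w) :=
    (hζ.continuous_fderiv (by simp)).clm_apply continuous_const
  have hdζc : HasCompactSupport fun z => fderiv ℝ ζ z (0, w) :=
    (hζc.fderiv ℝ).comp_left (g := fun T : 𝔽 × 𝔾 →L[ℝ] ℝ => T (0, w)) (by simp)
  have hd0 : ∀ z ∉ c.Φ.target, fderiv ℝ ζ z (0, w) = 0 := fun z hz => by
    rw [fderiv_of_notMem_tsupport ℝ fun h => hz (hζT h)]
    simp
  have hint : Integrable (fun z => f z * fderiv ℝ ζ z (0, w)) (volume : Measure (𝔽 × 𝔾)) :=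
    (integrableOn_iff_integrable_of_support_subset fun z hz => by
      by_contra h
      exact hz (by simp [hd0 z h])).1 (integrable_mul_of_hasCompactSupport hf hdζ hdζc)
  rw [setIntegral_eq_integral_of_forall_compl_eq_zero fun z hz => by rw [hd0 z hz, mul_zero]]
  rw [Measure.volume_eq_prod, integral_prod _ hint]
  refine integral_eq_zero_of_ae ?_
  filter_upwards [hc] with y hy
  have hζy : ContDiff ℝ ∞ fun n : 𝔾 => ζ (y, n) := hζ.comp (by fun_prop)
  have hfy : ∀ n, fderiv ℝ (fun n : 𝔾 => ζ (y, n)) n w = fderiv ℝ ζ (y, n) (0, w) := fun n => by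
    have h1 : HasFDerivAt (fun n : 𝔾 => ζ (y, n))
        ((fderiv ℝ ζ (y, n)).comp (ContinuousLinearMap.inr ℝ 𝔽 𝔾)) n :=
      ((hζ.differentiable (by simp)).differentiableAt.hasFDerivAt (x := (y, n))).comp n
        (hasFDerivAt_prodMk_right y n)
    rw [h1.fderiv]
    simp
  have hζyc : HasCompactSupport fun n : 𝔾 => ζ (y, n) :=
    HasCompactSupport.intro (hζc.isCompact.image continuous_snd) fun n hn =>
      image_eq_zero_of_notMem_tsupport fun h => hn ⟨_, h, rfl⟩
  have h0 : ∫ n, fderiv ℝ ζ (y, n) (0, w) = 0 := by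
    have := integral_mul_fderiv_eq_neg_of_contDiffOn (μ := (volume : Measure 𝔾)) isOpen_univ hζy
      hζyc (subset_univ _) (contDiffOn_const (c := (1 : ℝ))) w
    simpa [hfy] using this
  by_cases hyb : y ∈ Metric.ball c.y₀ c.ρ
  · obtain ⟨a, ha⟩ := hy hyb
    have h1 : ∫ n, f (y, n) * fderiv ℝ ζ (y, n) (0, w) =
        ∫ n, a * fderiv ℝ ζ (y, n) (0, w) := by
      refine integral_congr_ae ?_
      filter_upwards [ha] with n hn
      by_cases hnb : n ∈ Metric.ball c.n₀ c.ρ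
      · rw [hn hnb]
      · rw [hd0 _ fun h => hnb (c.mem_target.1 h).2, mul_zero, mul_zero]
    simp only [Pi.zero_apply]
    rw [h1, integral_const_mul, h0, mul_zero]
  · have h1 : ∀ n, fderiv ℝ ζ (y, n) (0, w) = 0 := fun n =>
      hd0 _ fun h => hyb (c.mem_target.1 h).1
    simp [h1]

/-- If `u` is almost everywhere constant along almost every plaque, then its gradient is
tangential. -/
theorem ae_gradient_mem_of_plaque_const (hkm : k + m = ℓ) (hΩ : IsOpen Ω) {u : 𝔼 → ℝ} {g : 𝔼 → 𝔼}
    (hg : IsL2WeakGradient Ω u g) (hu : IntegrableOn u Ω) (hgi : IntegrableOn g Ω)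
    (hc : ∀ᵐ y : 𝔽, y ∈ Metric.ball c.y₀ c.ρ →
      ∃ a, ∀ᵐ n : 𝔾, n ∈ Metric.ball c.n₀ c.ρ → u (c.Φ.symm (y, n)) = a) :
    ∀ᵐ x, x ∈ c.Φ.source → g x ∈ tangentSpaceAt M (φ x) := by
  have hto := c.Φ.open_target
  have h1 : ∀ w : 𝔾, ∀ᵐ z : 𝔽 × 𝔾, z ∈ c.Φ.target →
      inner ℝ (g (c.Φ.symm z)) (fderiv ℝ c.Φ.symm z (0, w)) = 0 := by
    intro w
    refine hto.ae_eq_zero_of_integral_contDiff_smul_eq_zero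
      (c.integrableOn_inner_fderiv_symm hkm (hgi.mono_set c.source_subset) w).locallyIntegrableOn
      fun ζ hζ hζc hζT => ?_
    have h2 := c.integral_mul_fderiv_eq hkm hΩ hg hu hgi hζ hζc hζT w
    rw [c.integral_mul_fderiv_eq_zero
      (c.integrableOn_comp_symm hkm (hu.mono_set c.source_subset)) hζ hζc hζT hc w] at h2
    rw [← setIntegral_eq_integral_of_forall_compl_eq_zero (s := c.Φ.target) fun z hz => by
      rw [image_eq_zero_of_notMem_tsupport fun h => hz (hζT h), zero_smul]]
    simpa using h2.symm
  -- The null set in `h1` depends on `w`; a basis yields a common one, and linearity recovers all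
  -- `w`.
  have h2 : ∀ᵐ z : 𝔽 × 𝔾, z ∈ c.Φ.target → ∀ i : Fin m, inner ℝ (g (c.Φ.symm z))
      (fderiv ℝ c.Φ.symm z (0, EuclideanSpace.basisFun (Fin m) ℝ i)) = 0 := by
    filter_upwards [ae_all_iff.2 fun i : Fin m => h1 (EuclideanSpace.basisFun (Fin m) ℝ i)]
      with z hz hzt i using hz i hzt
  have h3 := c.volume_symm_image_eq_zero hkm (N := {z | z ∈ c.Φ.target ∧ ¬ ∀ i : Fin m,
    inner ℝ (g (c.Φ.symm z))
      (fderiv ℝ c.Φ.symm z (0, EuclideanSpace.basisFun (Fin m) ℝ i)) = 0}) (fun z hz => hz.1)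
    (by simpa [ae_iff] using h2)
  refine measure_mono_null (fun x hx => ?_) h3
  simp only [mem_compl_iff, mem_ofPred_eq, not_forall] at hx
  obtain ⟨hxs, hx⟩ := hx
  refine ⟨c.Φ x, ⟨c.Φ.map_source hxs, fun hall => hx ?_⟩, c.Φ.left_inv hxs⟩
  rw [c.Φ.left_inv hxs] at hall
  -- The tangent space is its own double orthogonal complement, and every normal vector is a plaque
  -- direction.
  rw [← (tangentSpaceAt M (φ x)).orthogonal_orthogonal, Submodule.mem_orthogonal']
  intro v hv
  obtain ⟨w, rfl⟩ := c.exists_fderiv_symm_eq hxs hv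
  have h4 : (innerSL ℝ (g x)).comp ((fderiv ℝ c.Φ.symm (c.Φ x)).comp
      (ContinuousLinearMap.inr ℝ 𝔽 𝔾)) = 0 := by
    refine ContinuousLinearMap.coe_injective
      ((EuclideanSpace.basisFun (Fin m) ℝ).toBasis.ext fun i => ?_)
    simpa using hall i
  simpa using congrArg (fun T : 𝔾 →L[ℝ] ℝ => T w) h4

/-- A plaque is a continuous image of a ball, hence connected. -/
theorem plaque_subset_connectedComponentIn {y : 𝔽} (hy : y ∈ Metric.ball c.y₀ c.ρ) :
    (fun n => c.Φ.symm (y, n)) '' Metric.ball c.n₀ c.ρ ⊆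
      connectedComponentIn (normalSection Ω φ (c.ψ y)) (c.Φ.symm (y, c.n₀)) := by
  refine IsPreconnected.subset_connectedComponentIn ?_
    (mem_image_of_mem (fun n => c.Φ.symm (y, n)) (c.center_mem hy)) ?_
  · refine (convex_ball c.n₀ c.ρ).isPreconnected.image _ ?_
    exact c.Φ.continuousOn_symm.comp (by fun_prop) fun n hn => c.mem_target.2 ⟨hy, hn⟩
  · rintro _ ⟨n, hn, rfl⟩
    exact ⟨c.source_subset (c.symm_mem_source hy hn), c.map_symm hy hn⟩

end FiberChart

/-! ### From plaques to components of normal sections -/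

section Sections

variable {ℓ k m : ℕ} {M U Ω : Set (EuclideanSpace ℝ (Fin ℓ))}
  {φ : EuclideanSpace ℝ (Fin ℓ) → EuclideanSpace ℝ (Fin ℓ)} {u : EuclideanSpace ℝ (Fin ℓ) → ℝ}

local notation "𝔼" => EuclideanSpace ℝ (Fin ℓ)
local notation "𝔽" => EuclideanSpace ℝ (Fin k)
local notation "𝔾" => EuclideanSpace ℝ (Fin m)

/-- `u` is constant, outside small exceptional sets, on the connected components of the normal
sections of `Ω`. -/
def IsConstOnSections (k m : ℕ) (M U Ω : Set 𝔼) (φ : 𝔼 → 𝔼) (u : 𝔼 → ℝ) : Prop :=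
  ∃ Z ⊆ M, μH[(k : ℝ)] Z = 0 ∧ ∃ S : 𝔼 → Set 𝔼,
    (∀ p ∈ M \ Z, S p ⊆ normalSection U φ p ∧ μH[(m : ℝ)] (S p) = 0) ∧
    ∀ p ∈ M \ Z, ∀ y ∈ normalSection Ω φ p, ∃ a : ℝ,
      ∀ x ∈ connectedComponentIn (normalSection Ω φ p) y \ S p, u x = a

theorem IsConstOnSections.ae_plaque_const (hφM : MapsTo φ Ω M)
    (h : IsConstOnSections k m M U Ω φ u) (c : FiberChart k m M Ω φ) :
    ∀ᵐ y : 𝔽, y ∈ Metric.ball c.y₀ c.ρ →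
      ∃ a, ∀ᵐ n : 𝔾, n ∈ Metric.ball c.n₀ c.ρ → u (c.Φ.symm (y, n)) = a := by
  obtain ⟨Z, -, hZ0, S, hS, hconst⟩ := h
  filter_upwards [c.ae_param_notMem hZ0] with y hyZ hy
  have hn₀ := c.center_mem hy
  have hxΩ := c.source_subset (c.symm_mem_source hy hn₀)
  have hp : c.ψ y ∈ M \ Z := ⟨by
    rw [← c.map_symm hy hn₀]
    exact hφM hxΩ, hyZ hy⟩
  obtain ⟨a, ha⟩ := hconst _ hp _ ⟨hxΩ, c.map_symm hy hn₀⟩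
  refine ⟨a, ?_⟩
  filter_upwards [c.ae_symm_notMem (hS _ hp).2 hy] with n hnS hn
  exact ha _ ⟨c.plaque_subset_connectedComponentIn hy ⟨n, hn, rfl⟩, hnS hn⟩

open Classical in
/-- The almost everywhere constant value of `u` along the plaque over `y` (`0` if there is none). -/
noncomputable def FiberChart.plaqueValue (c : FiberChart k m M Ω φ) (u : 𝔼 → ℝ) (y : 𝔽) : ℝ :=
  if h : ∃ a, ∀ᵐ n : 𝔾, n ∈ Metric.ball c.n₀ c.ρ → u (c.Φ.symm (y, n)) = a then h.choose else 0

theorem FiberChart.ae_eq_plaqueValue (c : FiberChart k m M Ω φ) {y : 𝔽}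
    (h : ∃ a, ∀ᵐ n : 𝔾, n ∈ Metric.ball c.n₀ c.ρ → u (c.Φ.symm (y, n)) = a) :
    ∀ᵐ n : 𝔾, n ∈ Metric.ball c.n₀ c.ρ → u (c.Φ.symm (y, n)) = c.plaqueValue u y := by
  rw [FiberChart.plaqueValue, dif_pos h]
  exact h.choose_spec

/-- The points of the fiber over `p` in the chart at which `u` differs from the value of the
plaque. -/
def FiberChart.exceptionalSet (c : FiberChart k m M Ω φ) (u : 𝔼 → ℝ) (p : 𝔼) : Set 𝔼 :=
  {x | x ∈ c.Φ.source ∧ φ x = p ∧ u x ≠ c.plaqueValue u (c.Φ x).1}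

/-- Since `χ` determines `y` from `p`, the chart meets the fiber over `p` in at most one plaque, and
a Lipschitz map carries the null set of bad `n` onto the bad points. -/
theorem FiberChart.hausdorffMeasure_exceptionalSet (c : FiberChart k m M Ω φ) {p : 𝔼}
    (hp : ∀ y ∈ Metric.ball c.y₀ c.ρ, c.ψ y = p →
      ∃ a, ∀ᵐ n : 𝔾, n ∈ Metric.ball c.n₀ c.ρ → u (c.Φ.symm (y, n)) = a) :
    μH[(m : ℝ)] (c.exceptionalSet u p) = 0 := by
  rcases (c.exceptionalSet u p).eq_empty_or_nonempty with h | ⟨x₀, hx₀, hφx₀, -⟩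
  · rw [h, measure_empty]
  · have hy := (c.apply_mem hx₀).1
    have hae := c.ae_eq_plaqueValue (hp _ hy ((c.param _ hx₀).trans hφx₀))
    refine measure_mono_null ?_ (c.hausdorffMeasure_plaque_image_eq_zero hy
      (N := {n | ¬ (n ∈ Metric.ball c.n₀ c.ρ → u (c.Φ.symm ((c.Φ x₀).1, n)) =
        c.plaqueValue u (c.Φ x₀).1)}) (fun n hn => ?_) (ae_iff.1 hae))
    · rintro x ⟨hx, hφx, hux⟩
      have h1 : (c.Φ x).1 = (c.Φ x₀).1 := by
        rw [← c.coord x hx, ← c.coord x₀ hx₀, hφx, hφx₀]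
      have h2 : c.Φ.symm ((c.Φ x₀).1, (c.Φ x).2) = x := by
        rw [← h1]
        exact c.Φ.left_inv hx
      refine ⟨(c.Φ x).2, fun hall => hux ?_, h2⟩
      have h3 := hall (c.apply_mem hx).2
      rwa [h2, ← h1] at h3
    · by_contra h
      exact hn fun h' => absurd h' h

/-- The values of two plaques through a common point agree. -/
theorem FiberChart.plaqueValue_eq (c c' : FiberChart k m M Ω φ) {x : 𝔼} {S : Set 𝔼}
    (hx : x ∈ c.Φ.source) (hx' : x ∈ c'.Φ.source) (hS : μH[(m : ℝ)] S = 0)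
    (hcS : c.exceptionalSet u (φ x) ⊆ S) (hcS' : c'.exceptionalSet u (φ x) ⊆ S) :
    c.plaqueValue u (c.Φ x).1 = c'.plaqueValue u (c'.Φ x).1 := by
  obtain ⟨hy, hn⟩ := c.apply_mem hx
  set y := (c.Φ x).1 with hydef
  have hcont : ContinuousAt (fun n => c.Φ.symm (y, n)) (c.Φ x).2 :=
    ContinuousAt.comp (g := c.Φ.symm) (c.Φ.continuousAt_symm (c.Φ.map_source hx)) (by fun_prop)
  have hO : {n | n ∈ Metric.ball c.n₀ c.ρ ∧ c.Φ.symm (y, n) ∈ c'.Φ.source} ∈ 𝓝 (c.Φ x).2 := by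
    refine inter_mem (Metric.isOpen_ball.mem_nhds hn) (hcont (c'.Φ.open_source.mem_nhds ?_))
    have h1 : c.Φ.symm (y, (c.Φ x).2) = x := c.Φ.left_inv hx
    simpa only [h1] using hx'
  -- The two plaques share an open piece of positive measure, so some common point avoids `S`; there
  -- `u` takes both plaque values.
  obtain ⟨n, ⟨hnb, hns⟩, hnS⟩ := ((frequently_ae_mem_iff.2
    (measure_pos_of_mem_nhds volume hO).ne').and_eventually (c.ae_symm_notMem hS hy)).exists
  set x₁ := c.Φ.symm (y, n) with hx₁
  have hx₁s : x₁ ∈ c.Φ.source := c.symm_mem_source hy hnb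
  have hφx : φ x₁ = φ x := by rw [hx₁, c.map_symm hy hnb, c.param x hx]
  have key : ∀ d : FiberChart k m M Ω φ, x ∈ d.Φ.source → x₁ ∈ d.Φ.source →
      d.exceptionalSet u (φ x) ⊆ S → u x₁ = d.plaqueValue u (d.Φ x).1 := by
    intro d hdx hdx₁ hdS
    by_contra hne
    refine hnS hnb (hdS ⟨hdx₁, hφx, ?_⟩)
    rwa [← d.coord x₁ hdx₁, hφx, d.coord x hdx]
  rw [← key c hx hx₁s hcS, ← key c' hx' hns hcS']

/-- A countable subcover keeps the union of bad plaques and bad points null. The value `b` of the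
plaque through a point is independent of the chart, and within one chart the points of the section
over `p` lie on a single plaque; so `b` is locally constant on the section, hence constant on a
component. -/
theorem isConstOnSections_of_ae_plaque_const (hφM : MapsTo φ Ω M) (hΩU : Ω ⊆ U)
    (hchart : ∀ x ∈ Ω, ∃ c : FiberChart k m M Ω φ, x ∈ c.Φ.source)
    (hconst : ∀ c : FiberChart k m M Ω φ, ∀ᵐ y : 𝔽, y ∈ Metric.ball c.y₀ c.ρ →
      ∃ a, ∀ᵐ n : 𝔾, n ∈ Metric.ball c.n₀ c.ρ → u (c.Φ.symm (y, n)) = a) :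
    IsConstOnSections k m M U Ω φ u := by
  choose c hc using fun x : Ω => hchart x x.2
  obtain ⟨t, htc, htU⟩ := TopologicalSpace.countable_cover_nhds
    (f := fun x : Ω => ((↑) : Ω → 𝔼) ⁻¹' (c x).Φ.source) fun x =>
      ((c x).Φ.open_source.preimage continuous_subtype_val).mem_nhds (hc x)
  have hcover : ∀ x ∈ Ω, ∃ i ∈ t, x ∈ (c i).Φ.source := fun x hx => by
    have : (⟨x, hx⟩ : Ω) ∈ ⋃ i ∈ t, ((↑) : Ω → 𝔼) ⁻¹' (c i).Φ.source := htU ▸ mem_univ _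
    simpa using this
  set Y : Ω → Set 𝔽 := fun i => {y | ¬ (y ∈ Metric.ball (c i).y₀ (c i).ρ →
    ∃ a, ∀ᵐ n : 𝔾, n ∈ Metric.ball (c i).n₀ (c i).ρ → u ((c i).Φ.symm (y, n)) = a)} with hY
  have hYball : ∀ i, Y i ⊆ Metric.ball (c i).y₀ (c i).ρ := fun i y hy => by
    by_contra h
    exact hy fun h' => absurd h' h
  set Z : Set 𝔼 := ⋃ i ∈ t, (c i).ψ '' Y i with hZ
  set S : 𝔼 → Set 𝔼 := fun p => ⋃ i ∈ t, (c i).exceptionalSet u p with hS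
  have hS0 : ∀ p ∉ Z, μH[(m : ℝ)] (S p) = 0 := fun p hp =>
    (measure_biUnion_null_iff htc).2 fun i hi =>
      (c i).hausdorffMeasure_exceptionalSet fun y hy hyp => by
        by_contra hne
        exact hp (mem_biUnion hi ⟨y, fun hall => hne (hall hy), hyp⟩)
  have hSi : ∀ i ∈ t, ∀ p, (c i).exceptionalSet u p ⊆ S p := fun i hi p =>
    subset_biUnion_of_mem (u := fun i => (c i).exceptionalSet u p) hi
  refine ⟨Z, ?_, (measure_biUnion_null_iff htc).2 fun i _ =>
    (c i).hausdorffMeasure_param_image_eq_zero (hYball i) (ae_iff.1 (hconst (c i))), S,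
    fun p hp => ⟨?_, hS0 p hp.2⟩, fun p hp y hy => ?_⟩
  · refine iUnion₂_subset fun i _ => ?_
    rintro _ ⟨y, hy, rfl⟩
    have hyb := hYball i hy
    have hn := (c i).center_mem hyb
    rw [← (c i).map_symm hyb hn]
    exact hφM ((c i).source_subset ((c i).symm_mem_source hyb hn))
  · exact iUnion₂_subset fun i _ x hx => ⟨hΩU ((c i).source_subset hx.1), hx.2.1⟩
  have : Nonempty Ω := ⟨⟨y, hy.1⟩⟩
  choose! i hit hi using hcover
  set b : 𝔼 → ℝ := fun x => (c (i x)).plaqueValue u ((c (i x)).Φ x).1 with hb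
  set C := connectedComponentIn (normalSection Ω φ p) y with hC
  have hCs : C ⊆ normalSection Ω φ p := connectedComponentIn_subset _ _
  have hbeq : ∀ x ∈ C, ∀ j ∈ t, x ∈ (c j).Φ.source →
      b x = (c j).plaqueValue u ((c j).Φ x).1 := by
    intro x hx j hj hxj
    obtain ⟨hxΩ, hxp⟩ := hCs hx
    refine FiberChart.plaqueValue_eq _ _ (hi x hxΩ) hxj (hS0 p hp.2) ?_ ?_
    · rw [hxp]
      exact hSi _ (hit x hxΩ) p
    · rw [hxp]
      exact hSi _ hj p
  have hyC : y ∈ C := mem_connectedComponentIn hy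
  have hbC : ∀ x ∈ C, b x = b y := by
    have : PreconnectedSpace C :=
      Subtype.preconnectedSpace isPreconnected_connectedComponentIn
    have hloc : IsLocallyConstant fun x : C => b x := by
      rw [IsLocallyConstant.iff_eventually_eq]
      intro x
      obtain ⟨hxΩ, hxp⟩ := hCs x.2
      have hnhds : ∀ᶠ x' : C in 𝓝 x, (x' : 𝔼) ∈ (c (i x)).Φ.source :=
        ((c (i x)).Φ.open_source.preimage continuous_subtype_val).mem_nhds (hi x hxΩ)
      filter_upwards [hnhds] with x' hx'
      rw [hbeq x' x'.2 _ (hit x hxΩ) hx', ← (c (i x)).coord _ hx', (hCs x'.2).2, ← hxp,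
        (c (i x)).coord _ (hi x hxΩ)]
    exact fun x hx => hloc.apply_eq_of_preconnectedSpace ⟨x, hx⟩ ⟨y, hyC⟩
  refine ⟨b y, fun x hx => ?_⟩
  rw [← hbC x hx.1]
  obtain ⟨hxΩ, hxp⟩ := hCs hx.1
  by_contra hne
  exact hx.2 (hSi _ (hit x hxΩ) p ⟨hi x hxΩ, hxp, hne⟩)

theorem ae_gradient_mem_iff_isConstOnSections (hkm : k + m = ℓ) (hΩ : IsOpen Ω) {g : 𝔼 → 𝔼}
    (hg : IsL2WeakGradient Ω u g) (hu : IntegrableOn u Ω) (hgi : IntegrableOn g Ω)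
    (hφM : MapsTo φ Ω M) (hΩU : Ω ⊆ U)
    (hchart : ∀ x ∈ Ω, ∃ c : FiberChart k m M Ω φ, x ∈ c.Φ.source) :
    (∀ᵐ x, x ∈ Ω → g x ∈ tangentSpaceAt M (φ x)) ↔ IsConstOnSections k m M U Ω φ u := by
  refine ⟨fun h => isConstOnSections_of_ae_plaque_const hφM hΩU hchart fun c =>
    c.ae_plaque_const_of_gradient_mem hkm hΩ hg hu hgi
      (h.mono fun x hx hxs => hx (c.source_subset hxs)), fun h => ?_⟩
  -- Tangentiality of the gradient is checked chart by chart, since a locally null set is null.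
  refine measure_null_of_locally_null _ fun x hx => ?_
  have hxΩ : x ∈ Ω := by
    by_contra hn
    exact hx fun h' => absurd h' hn
  obtain ⟨c, hc⟩ := hchart x hxΩ
  refine ⟨c.Φ.source ∩ {x | x ∈ Ω → g x ∈ tangentSpaceAt M (φ x)}ᶜ,
    inter_mem (mem_nhdsWithin_of_mem_nhds (c.Φ.open_source.mem_nhds hc)) self_mem_nhdsWithin, ?_⟩
  refine measure_mono_null ?_ (c.ae_gradient_mem_of_plaque_const hkm hΩ hg hu hgi
    (h.ae_plaque_const hφM c))
  exact fun x hx hall => hx.2 fun _ => hall hx.1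

end Sections

end ThinDomain

/-! ### The equivalence on a bounded domain -/

theorem corollary3p2 (ℓ k r : ℕ) (hk : 1 ≤ k) (hkℓ : k < ℓ) (hr : 2 ≤ r)
    (M U Ω : Set (EuclideanSpace ℝ (Fin ℓ)))
    (φ : EuclideanSpace ℝ (Fin ℓ) → EuclideanSpace ℝ (Fin ℓ))
    (hM : ThinDomain.IsImbeddedSubmanifold r k M)
    (hφ : ThinDomain.IsTubularProjection r M U φ)
    (hΩo : IsOpen Ω) (hΩc : IsConnected Ω) (hΩb : Bornology.IsBounded Ω) (hΩU : closure Ω ⊆ U)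
    (u : EuclideanSpace ℝ (Fin ℓ) → ℝ) (hu : ThinDomain.MemH1 Ω u) :
    (∀ᵐ x ∂(volume.restrict Ω),
        ThinDomain.normalProj M φ x (ThinDomain.weakGradient Ω u x) = 0) ↔
      ∃ Z ⊆ M, μH[(k : ℝ)] Z = 0 ∧
        ∃ S : EuclideanSpace ℝ (Fin ℓ) → Set (EuclideanSpace ℝ (Fin ℓ)),
          (∀ p ∈ M \ Z, S p ⊆ ThinDomain.normalSection U φ p ∧ μH[((ℓ - k : ℕ) : ℝ)] (S p) = 0) ∧
          ∀ p ∈ M \ Z, ∀ y ∈ ThinDomain.normalSection Ω φ p, ∃ c : ℝ,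
            ∀ x ∈ connectedComponentIn (ThinDomain.normalSection Ω φ p) y \ S p, u x = c := by
  have hsub : Ω ⊆ U := subset_closure.trans hΩU
  -- Finite measure makes the square integrable `u` and its gradient integrable on `Ω`.
  have hfin : IsFiniteMeasure (volume.restrict Ω) :=
    isFiniteMeasure_restrict.2 hΩb.measure_lt_top.ne
  rw [ae_restrict_iff' hΩo.measurableSet]
  simp only [ThinDomain.normalProj_eq_zero_iff]
  exact ThinDomain.ae_gradient_mem_iff_isConstOnSections (Nat.add_sub_cancel' hkℓ.le) hΩo
    hu.isL2WeakGradient (hu.1.integrable one_le_two) (hu.isL2WeakGradient.1.integrable one_le_two)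
    (hφ.mapsTo.mono_left hsub) hsub
    fun x hx => ThinDomain.exists_fiberChart hkℓ hr hM hφ hΩo hsub hx
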